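/- **Model.** Take the centre $E$ of the Earth as origin. An aerial transmitter $R=(0,0,w_{er})$, $w_{er}=w_e+h_0$, hovers at altitude $h_0>0$ above the ground plane at distance $w_e>0$ from $E$. The satellite $S$ is uniformly distributed (surface area) on the part of the sphere of radius $w_{er}+w_{\min}$ about $E$ that lies above the horizontal plane through $R$ ($w_{\min}>0$). The ground user $D$ is uniformly distributed on the disc of radius $l>0$ in the ground plane centred vertically below $R$. Put $w_{sr}=|S-R|$, $w_{rd}=|R-D|$ and $w_{\max}=\sqrt{w_{\min}^2+2w_{er}w_{\min}}$. The channel gain $|g_{sr}|^2$ is shadowed-Rician with an integer $m_{sr}\ge1$, $\flat>0$, $\Omega\ge0$: its density on $x\ge 0$ is $\alpha\sum_{k=0}^{m_{sr}-1}\zeta(k)x^ke^{-\bar\beta x}$, where $\alpha=\frac1{2\flat}\left(\frac{2\flat m_{sr}}{2\flat m_{sr}+\Omega}\right)^{m_{sr}}$, $\beta=\frac1{2\flat}$, $\delta=\frac{\Omega}{2\flat(2\flat m_{sr}+\Omega)}$, $\bar\beta=\beta-\delta$, $\zeta(k)=(-1)^k(1-m_{sr})_k\delta^k/(k!)^2$.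 The gain $|g_{rd}|^2$ (Nakagami-$m$ fading) has density $\frac{m_{rd}^{m_{rd}}}{\Gamma(m_{rd})}x^{m_{rd}-1}e^{-m_{rd}x}$ on $x\ge0$ with an integer $m_{rd}\ge1$. The four variables $|g_{sr}|^2,|g_{rd}|^2,w_{sr},w_{rd}$ are independent. Let $\nu>0$ (path-loss exponent), $\eta_s>0$, $P_{th}\in\mathbb R$, $\chi,\mu\in(0,1)$, $\rho,\varepsilon\in[0,1)$ not both $0$, and noise powers $\sigma_r^2,\sigma_{rb}^2,\sigma_d^2>0$. Put $\chi_{\rho,\varepsilon}=\chi\left(\frac{2\rho}{1-\rho}+\varepsilon\right)$, $\mu_\varepsilon=\mu\left(\sigma_r^2+\frac{\sigma_{rb}^2}{1-\varepsilon}\right)$, $\mu'=\frac{\mu}{1-\mu}$, and, for $\gamma_S>0$, $A=\chi_{\rho,\varepsilon}\eta_s(\mu-(1-\mu)\gamma_S)$, $B=\mu_\varepsilon\chi_{\rho,\varepsilon}\gamma_S$, $P_{A,B}=P_{th}A/\eta_s-B$. Let $$\Lambda_1=\frac{\mu\chi_{\rho,\varepsilon}\eta_s|g_{sr}|^2w_{sr}^{-2}|g_{rd}|^2w_{rd}^{-\nu}}{\mu_\varepsilon\chi_{\rho,\varepsilon}|g_{rd}|^2w_{rd}^{-\nu}+(1-\mu)\chi_{\rho,\varepsilon}\eta_s|g_{sr}|^2w_{sr}^{-2}|g_{rd}|^2w_{rd}^{-\nu}+\sigma_d^2}$$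 be the signal-to-noise ratio at the ground user when the energy harvester works in its linear region, and $$P_1(\gamma_S)=\Pr\left[\Lambda_1>\gamma_S,\ \eta_s|g_{sr}|^2w_{sr}^{-2}\le P_{th}\right].$$ **Theorem.** For every $\gamma_S>0$, $$P_1(\gamma_S)=\begin{cases}\Psi_1(\gamma_S),&\gamma_S<\mu'\text{ and }P_{th}\ge (B/A)\eta_s,\\0,&\gamma_S<\mu'\text{ and }P_{th}<(B/A)\eta_s,\\0,&\gamma_S\ge\mu',\end{cases}$$ where, with $\varsigma_1=1+k_1+k_2-n$ and $\Delta_\Gamma(s,x,y)=\Gamma(s,x)-\Gamma(s,y)$ (upper incomplete Gamma functions), $$\Psi_1(\gamma_S)=\frac{\alpha A}{l^2w_{er}w_{\min}\nu}\sum_{k=0}^{m_{sr}-1}\zeta(k)\sum_{k_1=0}^{k}\binom k{k_1}\sum_{k_2=0}^{\infty}\frac{(-1)^{k_2}B^{-k_1-k_2-2}}{\bar\beta^{k+2}k_2!}\Delta_\Gamma\left(k+k_2+2,\tfrac{\bar\beta Bw_{\min}^2}{A},\tfrac{\bar\beta Bw_{\max}^2}{A}\right)\sum_{n=0}^{m_{rd}-1}P_{A,B}^{\varsigma_1}\frac{(m_{rd}\sigma_d^2\gamma_S)^n}{n!}$$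 $$\times\left[(h_0^2+l^2)^{\frac{\nu n+2}2}\,\mathcal G\!\left(\sqrt{h_0^2+l^2}\right)-h_0^{\nu n+2}\,\mathcal G(h_0)\right],\qquad \mathcal G(v)=G^{2,1}_{2,3}\left[\frac{m_{rd}\sigma_d^2\gamma_S v^{\nu}}{P_{A,B}}\,\middle|\,{1-n-\frac2\nu,\ \varsigma_1+1\atop \varsigma_1,\ 0,\ -n-\frac2\nu}\right],$$ with $G^{2,1}_{2,3}$ the Meijer $G$-function; each of the infinite series over $k_2$ converges absolutely. In the boundary case $P_{th}=(B/A)\eta_s$, where $P_{A,B}=0$, the terms of $\Psi_1$ are read as their limit $0$ for $P_{A,B}\downarrow0$, and $P_1(\gamma_S)=0$. -/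

import Mathlib

open MeasureTheory ProbabilityTheory

noncomputable section

/-! ## Special functions -/

/-- The upper incomplete Gamma function `Γ(s, x) = ∫_x^∞ t^(s-1) e^(-t) dt`. -/
def upperGamma (s x : ℝ) : ℝ := ∫ t in Set.Ioi x, t ^ (s - 1) * Real.exp (-t)

/-- `Δ_Γ(s, x, y) = Γ(s, x) - Γ(s, y)`. -/
def deltaGamma (s x y : ℝ) : ℝ := upperGamma s x - upperGamma s y

/-- The Mellin–Barnes integrand of the Meijer function `G^{m,n}_{p,q}[z | a; b]`:
`∏_{j ≤ m} Γ(b_j - s) ∏_{j ≤ n} Γ(1 - a_j + s) z^s /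
  (∏_{j > m} Γ(1 - b_j + s) ∏_{j > n} Γ(a_j - s))`. -/
def meijerIntegrand (m n : ℕ) {p q : ℕ} (a : Fin p → ℂ) (b : Fin q → ℂ) (z s : ℂ) : ℂ :=
  (∏ j : Fin q, if (j : ℕ) < m then Complex.Gamma (b j - s)
      else (Complex.Gamma (1 - b j + s))⁻¹) *
  (∏ j : Fin p, if (j : ℕ) < n then Complex.Gamma (1 - a j + s)
      else (Complex.Gamma (a j - s))⁻¹) * z ^ s

/-- The line `Re s = c` has all poles of `Γ(b_j - s)`, `j ≤ m`, on its right and all poles of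
`Γ(1 - a_j + s)`, `j ≤ n`, on its left. -/
def MeijerSeparates (m n : ℕ) {p q : ℕ} (a : Fin p → ℂ) (b : Fin q → ℂ) (c : ℝ) : Prop :=
  (∀ j : Fin q, (j : ℕ) < m → c < (b j).re) ∧ (∀ j : Fin p, (j : ℕ) < n → (a j).re - 1 < c)

open Classical in
/-- The Meijer `G`-function `G^{m,n}_{p,q}[z | a; b] = (1 / 2πi) ∫_L (integrand) ds` along a
vertical line `L` that separates the two families of poles (with `s = c + iy`, `ds = i dy`). By
Cauchy's theorem the value does not depend on the separating line. For parameters that no vertical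
line separates (a bent contour would be needed) the value here is `0`; for the parameters used
below a separating line always exists, see `meijer_separates`. -/
def meijerG (m n : ℕ) {p q : ℕ} (a : Fin p → ℂ) (b : Fin q → ℂ) (z : ℂ) : ℂ :=
  if h : ∃ c : ℝ, MeijerSeparates m n a b c then
    (1 / (2 * (Real.pi : ℂ))) *
      ∫ y : ℝ, meijerIntegrand m n a b z ((h.choose : ℂ) + (y : ℂ) * Complex.I)
  else 0

/-! ## Parameters of the network -/

/-- The numerical parameters of the system. -/
structure Params where
  /-- fading severity of the (shadowed-Rician) satellite link -/
  mS : ℕ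
  /-- half the average power of the multipath component of the satellite link -/
  b : ℝ
  /-- average power of the line-of-sight component of the satellite link -/
  Om : ℝ
  /-- fading severity of the (Nakagami) ground link -/
  mD : ℕ
  /-- path-loss exponent of the ground link -/
  nu : ℝ
  /-- radius of the Earth -/
  wE : ℝ
  /-- minimum distance between the satellite and the aerial transmitter -/
  wMin : ℝ
  /-- altitude of the aerial transmitter -/
  h0 : ℝ
  /-- radius of the disc of ground users -/
  l : ℝ
  /-- transmit power of the satellite, times the deterministic gains of its link -/
  etaS : ℝ
  /-- saturation threshold power of the energy harvester -/
  Pth : ℝ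
  /-- energy conversion efficiency -/
  chi : ℝ
  /-- time-switching fraction -/
  rho : ℝ
  /-- power-splitting fraction -/
  eps : ℝ
  /-- spectrum sharing factor -/
  mu : ℝ
  /-- noise power at the aerial transmitter -/
  sigmaR2 : ℝ
  /-- RF-to-baseband conversion noise power at the aerial transmitter -/
  sigmaRB2 : ℝ
  /-- noise power at the ground user -/
  sigmaD2 : ℝ

namespace Params

/-- The admissible parameter values. -/
structure Valid (p : Params) : Prop where
  mS_pos : 0 < p.mS
  b_pos : 0 < p.b
  Om_nonneg : 0 ≤ p.Om
  mD_pos : 0 < p.mD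
  nu_pos : 0 < p.nu
  wE_pos : 0 < p.wE
  wMin_pos : 0 < p.wMin
  h0_pos : 0 < p.h0
  l_pos : 0 < p.l
  etaS_pos : 0 < p.etaS
  chi_pos : 0 < p.chi
  chi_lt_one : p.chi < 1
  rho_nonneg : 0 ≤ p.rho
  rho_lt_one : p.rho < 1
  eps_nonneg : 0 ≤ p.eps
  eps_lt_one : p.eps < 1
  harvests : 0 < p.rho ∨ 0 < p.eps
  mu_pos : 0 < p.mu
  mu_lt_one : p.mu < 1
  sigmaR2_pos : 0 < p.sigmaR2
  sigmaRB2_pos : 0 < p.sigmaRB2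
  sigmaD2_pos : 0 < p.sigmaD2

variable (p : Params)

/-- `α_sr = (2♭m / (2♭m + Ω))^m / (2♭)` -/
def alpha : ℝ := (2 * p.b * p.mS / (2 * p.b * p.mS + p.Om)) ^ p.mS / (2 * p.b)

/-- `β_sr = 1 / (2♭)` -/
def beta : ℝ := 1 / (2 * p.b)

/-- `δ_sr = Ω / ((2♭)(2♭m + Ω))` -/
def delta : ℝ := p.Om / ((2 * p.b) * (2 * p.b * p.mS + p.Om))

/-- `β̄_sr = β_sr - δ_sr` -/
def betaBar : ℝ := p.beta - p.delta

/-- `ζ(k) = (-1)^k (1 - m)_k δ^k / (k!)^2`, with the Pochhammer symbol `(x)_k`. -/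
def zeta (k : ℕ) : ℝ :=
  (-1) ^ k * (ascPochhammer ℝ k).eval (1 - (p.mS : ℝ)) * p.delta ^ k / ((k.factorial : ℝ)) ^ 2

/-- The shadowed-Rician law of the channel power gain `|g_sr|²`. -/
def shadowedRicianLaw : Measure ℝ :=
  (volume.restrict (Set.Ici 0)).withDensity fun x =>
    ENNReal.ofReal
      (p.alpha * ∑ k ∈ Finset.range p.mS, p.zeta k * x ^ k * Real.exp (-(p.beta - p.delta) * x))

/-- The law of `|g_rd|²` under Nakagami-`m` fading of unit mean power: the Gamma law with shape `m`
and rate `m`, of density `m^m / Γ(m) x^(m-1) e^(-m x)` on `x ≥ 0`. -/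
def nakagamiPowerLaw : Measure ℝ := gammaMeasure p.mD p.mD

/-- Distance of the aerial transmitter from the centre of the Earth. -/
def wER : ℝ := p.wE + p.h0

/-- Maximum distance between the satellite and the aerial transmitter. -/
def wMax : ℝ := Real.sqrt (p.wMin ^ 2 + 2 * p.wER * p.wMin)

/-- Position of the aerial transmitter; the centre of the Earth is the origin. -/
def posR : EuclideanSpace ℝ (Fin 3) := !₂[0, 0, p.wER]

/-- The directions, from the centre of the Earth, of the part of the satellite's orbital sphere (of
radius `w_er + w_min`) that lies above the horizontal plane through the aerial transmitter. -/
def capDirections : Set (Metric.sphere (0 : EuclideanSpace ℝ (Fin 3)) 1) :=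
  {u | p.wER ≤ (p.wER + p.wMin) * (u : EuclideanSpace ℝ (Fin 3)) 2}

/-- The law of the satellite's position: uniform (with respect to surface area) on the part of the
orbital sphere above the horizontal plane through the aerial transmitter. -/
def satelliteLaw : Measure (EuclideanSpace ℝ (Fin 3)) :=
  (ProbabilityTheory.cond
      (volume : Measure (EuclideanSpace ℝ (Fin 3))).toSphere p.capDirections).map
    fun u : Metric.sphere (0 : EuclideanSpace ℝ (Fin 3)) 1 =>
      (p.wER + p.wMin) • (u : EuclideanSpace ℝ (Fin 3))

/-- The law of the ground user's position: uniform on the disc of radius `l` in the ground plane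
whose centre lies vertically below the aerial transmitter. -/
def groundUserLaw : Measure (EuclideanSpace ℝ (Fin 3)) :=
  (ProbabilityTheory.cond (volume : Measure (EuclideanSpace ℝ (Fin 2)))
      (Metric.closedBall 0 p.l)).map
    fun x : EuclideanSpace ℝ (Fin 2) => (!₂[x 0, x 1, p.wE] : EuclideanSpace ℝ (Fin 3))

/-- `χ_{ρ,ε} = χ (2ρ / (1-ρ) + ε)` -/
def chiRE : ℝ := p.chi * (2 * p.rho / (1 - p.rho) + p.eps)

/-- `μ_ε = μ (σ_r² + σ_rb² / (1-ε))` -/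
def muE : ℝ := p.mu * (p.sigmaR2 + p.sigmaRB2 / (1 - p.eps))

/-- `μ' = μ / (1-μ)` -/
def muPrime : ℝ := p.mu / (1 - p.mu)

/-- `A = χ_{ρ,ε} η_s (μ - (1-μ) γ)` -/
def A (γ : ℝ) : ℝ := p.chiRE * p.etaS * (p.mu - (1 - p.mu) * γ)

/-- `B = μ_ε χ_{ρ,ε} γ` -/
def B (γ : ℝ) : ℝ := p.muE * p.chiRE * γ

/-- `P_{A,B} = P_th A / η_s - B` -/
def PAB (γ : ℝ) : ℝ := p.Pth * p.A γ / p.etaS - p.B γ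

/-- The SNR `Λ_{D,1}` at the ground user when the harvester works in its linear region, as a
function of `x = |g_sr|²`, `w = w_sr`, `y = |g_rd|²` and `v = w_rd`. -/
def snrLinear (x w y v : ℝ) : ℝ :=
  p.mu * p.chiRE * p.etaS * x * w ^ (-2 : ℤ) * y * v ^ (-p.nu) /
    (p.muE * p.chiRE * y * v ^ (-p.nu)
      + (1 - p.mu) * p.chiRE * p.etaS * x * w ^ (-2 : ℤ) * y * v ^ (-p.nu) + p.sigmaD2)

/-- `P₁(γ) = Pr[Λ_{D,1} > γ, η_s |g_sr|² w_sr^{-2} ≤ P_th]`, for the channel coefficients `gsr`,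
`grd` and the positions `S`, `D` of the satellite and of the ground user. -/
def P1 {Ω : Type*} [MeasurableSpace Ω] (P : Measure Ω) (gsr grd : Ω → ℂ)
    (S D : Ω → EuclideanSpace ℝ (Fin 3)) (γ : ℝ) : ℝ :=
  P.real {ω |
    γ < p.snrLinear (‖gsr ω‖ ^ 2) (dist (S ω) p.posR) (‖grd ω‖ ^ 2) (dist p.posR (D ω)) ∧
    p.etaS * ‖gsr ω‖ ^ 2 * dist (S ω) p.posR ^ (-2 : ℤ) ≤ p.Pth}

/-- `ς₁ = 1 + k₁ + k₂ - n` -/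
def varsigma1 (k₁ k₂ n : ℕ) : ℤ := 1 + (k₁ : ℤ) + (k₂ : ℤ) - (n : ℤ)

/-- Upper parameters `1 - n - 2/ν, ς₁ + 1` of the Meijer functions. -/
def meijerTop (k₁ k₂ n : ℕ) : Fin 2 → ℂ :=
  ![1 - (n : ℂ) - 2 / (p.nu : ℂ), (varsigma1 k₁ k₂ n : ℂ) + 1]

/-- Lower parameters `ς₁, 0, -n - 2/ν` of the Meijer functions. -/
def meijerBot (k₁ k₂ n : ℕ) : Fin 3 → ℂ :=
  ![(varsigma1 k₁ k₂ n : ℂ), 0, -(n : ℂ) - 2 / (p.nu : ℂ)]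

/-- For these parameters a vertical line separates the poles, so that `meijerG` is given by the
contour integral. -/
theorem meijer_separates (hp : p.Valid) (k₁ k₂ n : ℕ) :
    ∃ c : ℝ, MeijerSeparates 2 1 (p.meijerTop k₁ k₂ n) (p.meijerBot k₁ k₂ n) c := by
  have hν : 0 < 2 / p.nu := div_pos two_pos hp.nu_pos
  have hre : (2 / (p.nu : ℂ)).re = 2 / p.nu := by
    rw [show (2 / (p.nu : ℂ)) = ((2 / p.nu : ℝ) : ℂ) by push_cast; rfl, Complex.ofReal_re]
  have h1 : (0 : ℝ) ≤ k₁ := Nat.cast_nonneg _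
  have h2 : (0 : ℝ) ≤ k₂ := Nat.cast_nonneg _
  have h3 : (0 : ℝ) ≤ n := Nat.cast_nonneg _
  refine ⟨-(n : ℝ) - (2 / p.nu) / 2, fun j hj => ?_, fun j hj => ?_⟩
  · fin_cases j
    · simp [meijerBot, varsigma1]; linarith
    · simp [meijerBot]; linarith
    · simp at hj
  · fin_cases j
    · simp [meijerTop, hre]; linarith
    · simp at hj

/-- The factor
`G^{2,1}_{2,3}[m σ_d² γ v^ν / P_{A,B} | 1 - n - 2/ν, ς₁ + 1; ς₁, 0, -n - 2/ν]`. -/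
def meijerFactor (γ v : ℝ) (k₁ k₂ n : ℕ) : ℂ :=
  meijerG 2 1 (p.meijerTop k₁ k₂ n) (p.meijerBot k₁ k₂ n)
    ((p.mD * p.sigmaD2 * γ * v ^ p.nu / p.PAB γ : ℝ) : ℂ)

/-- The `k₂`-th term of the infinite series in `Ψ₁(γ)`, for given `k` and `k₁`. -/
def psiTerm (γ : ℝ) (k k₁ k₂ : ℕ) : ℂ :=
  (((-1) ^ k₂ * p.B γ ^ (-(k₁ : ℤ) - (k₂ : ℤ) - 2) / (p.betaBar ^ (k + 2) * (k₂.factorial : ℝ)) *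
      deltaGamma ((k : ℝ) + k₂ + 2) (p.betaBar * p.B γ * p.wMin ^ 2 / p.A γ)
        (p.betaBar * p.B γ * p.wMax ^ 2 / p.A γ) : ℝ) : ℂ) *
  ∑ n ∈ Finset.range p.mD,
    ((p.PAB γ ^ varsigma1 k₁ k₂ n * (p.mD * p.sigmaD2 * γ) ^ n / (n.factorial : ℝ) : ℝ) : ℂ) *
    ((((p.h0 ^ 2 + p.l ^ 2) ^ ((p.nu * n + 2) / 2) : ℝ) : ℂ) *
        p.meijerFactor γ (Real.sqrt (p.h0 ^ 2 + p.l ^ 2)) k₁ k₂ n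
      - ((p.h0 ^ (p.nu * n + 2) : ℝ) : ℂ) * p.meijerFactor γ p.h0 k₁ k₂ n)

/-- The closed form `Ψ₁(γ)`. -/
def Psi1 (γ : ℝ) : ℂ :=
  ((p.alpha * p.A γ / (p.l ^ 2 * p.wER * p.wMin * p.nu) : ℝ) : ℂ) *
    ∑ k ∈ Finset.range p.mS, (p.zeta k : ℂ) *
      ∑ k₁ ∈ Finset.range (k + 1), (k.choose k₁ : ℂ) * ∑' k₂ : ℕ, p.psiTerm γ k k₁ k₂

end Params

end

/-! Put `u = w_sr²`, `r = w_rd²`, `x = |g_sr|²`, `y = |g_rd|²`. Both squared distances are uniform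
on intervals: the first by Archimedes' hat-box theorem, because it is affine in the height of the
satellite, the second because disc areas are linear in the squared radius
(`Params.Valid.map_satelliteLaw`, `Params.Valid.map_groundUserLaw`).

Clearing denominators turns the SNR condition into `γ σ_d² r^(ν/2) < y (A x/u - B)`. If no `t = x/u`
allowed by the power threshold satisfies `A t > B`, the event is empty; this covers the zero cases.
Otherwise integrating out `y` gives the tail of a Gamma law of integer shape, a finite sum over `n`,
and the substitution `τ = A x/u - B` gives an integral over a box in `(u, r, τ)`
(`Params.Valid.P1_eq_integral`).

The shadowed-Rician density at `x = u (τ + B)/A` is expanded by the binomial theorem (index `k₁`)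
and by the exponential series of `exp(-β̄ u τ/A)` (index `k₂`), which separates `u` from `τ`;
dominated convergence justifies termwise integration. The `u`-integral is a difference of incomplete
Gamma functions. The `(r, τ)`-integral rescales to the integral of `q^(a-1) t^(s-1) exp(-X q/t)`
over the unit square, with `a = n + 2/ν` and `s = ς₁`. Its Mellin transform is `Γ(w) /
((a-w)(s+w))`, and since `1/z = Γ(z)/Γ(z+1)`, Mellin inversion identifies it with the Meijer
function (`meijerG_eq_expRatioIntegral`). -/

noncomputable section

/-! ## The real integral behind the Meijer function -/

/-- Lebesgue measure on the open unit square. -/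
def unitSquare : Measure (ℝ × ℝ) :=
  (volume.restrict (Set.Ioo (0 : ℝ) 1)).prod (volume.restrict (Set.Ioo (0 : ℝ) 1))

instance : SFinite unitSquare := by unfold unitSquare; infer_instance

/-- The integrand `q^(a-1) t^(s-1) exp(-x q / t)`. -/
def expRatio (a s x : ℝ) (p : ℝ × ℝ) : ℝ :=
  p.1 ^ (a - 1) * p.2 ^ (s - 1) * Real.exp (-(p.1 / p.2 * x))

/-- `∫_0^1 ∫_0^1 q^(a-1) t^(s-1) exp(-x q / t) dt dq`. -/
def expRatioIntegral (a s x : ℝ) : ℝ := ∫ p, expRatio a s x p ∂unitSquare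

theorem ae_unitSquare : ∀ᵐ p ∂unitSquare, p.1 ∈ Set.Ioo (0 : ℝ) 1 ∧ p.2 ∈ Set.Ioo (0 : ℝ) 1 := by
  unfold unitSquare
  rw [Measure.prod_restrict]
  exact ae_restrict_mem (measurableSet_Ioo.prod measurableSet_Ioo)

theorem measurable_expRatio (a s : ℝ) :
    Measurable fun z : ℝ × (ℝ × ℝ) => expRatio a s z.1 z.2 := by
  unfold expRatio; fun_prop

theorem integral_Ioo_rpow_mul_cpow {a : ℝ} {w : ℂ} (h : 0 < a + w.re) :
    ∫ q in Set.Ioo (0 : ℝ) 1, ((q ^ (a - 1) : ℝ) : ℂ) * (q : ℂ) ^ w = 1 / (a + w) := by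
  have h1 : ∫ q in Set.Ioo (0 : ℝ) 1, ((q ^ (a - 1) : ℝ) : ℂ) * (q : ℂ) ^ w
      = ∫ q in Set.Ioo (0 : ℝ) 1, (q : ℂ) ^ ((a : ℂ) + w - 1) := by
    refine setIntegral_congr_fun measurableSet_Ioo fun q hq => ?_
    have hq0 : (q : ℂ) ≠ 0 := by exact_mod_cast hq.1.ne'
    rw [Complex.ofReal_cpow hq.1.le, ← Complex.cpow_add _ _ hq0]
    congr 1
    push_cast; ring
  rw [h1, ← integral_Ioc_eq_integral_Ioo, ← intervalIntegral.integral_of_le zero_le_one,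
    integral_cpow (Or.inl (by simp; linarith))]
  have h2 : (a : ℂ) + w ≠ 0 := fun h0 => by
    have := congrArg Complex.re h0
    simp at this; linarith
  simp [h2]

theorem integrableOn_rpow_mul_exp_neg_mul_Ioi {σ r : ℝ} (hσ : 0 < σ) (hr : 0 < r) :
    IntegrableOn (fun x : ℝ => x ^ (σ - 1) * Real.exp (-(r * x))) (Set.Ioi 0) := by
  have := integrableOn_rpow_mul_exp_neg_mul_rpow (p := 1) (s := σ - 1) (b := r) (by linarith)
    one_pos hr
  simpa using this

/-- Tonelli with `x` innermost: the `x`-integral is `Γ(σ) q^(a-1-σ) t^(s-1+σ)`, integrable on the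
square because `σ < a` and `s + σ > 0`. The number `σ` is a point of the strip `max(0, -s) < Re w <
a` in which the Mellin transform lives; `s` itself may be negative. -/
theorem integrable_expRatio_prod {a s σ : ℝ} (h0 : 0 < σ) (hs : 0 < s + σ) (ha : σ < a) :
    Integrable (fun z : ℝ × (ℝ × ℝ) => z.1 ^ (σ - 1) * expRatio a s z.1 z.2)
      ((volume.restrict (Set.Ioi 0)).prod unitSquare) := by
  have hm : Measurable fun z : ℝ × (ℝ × ℝ) => z.1 ^ (σ - 1) * expRatio a s z.1 z.2 :=
    (measurable_fst.pow_const _).mul (measurable_expRatio a s)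
  rw [integrable_prod_iff' hm.aestronglyMeasurable]
  constructor
  · filter_upwards [ae_unitSquare] with p hp
    have := (integrableOn_rpow_mul_exp_neg_mul_Ioi h0 (div_pos hp.1.1 hp.2.1)).const_mul
      (p.1 ^ (a - 1) * p.2 ^ (s - 1))
    refine this.congr (Filter.Eventually.of_forall fun x => ?_)
    simp only [expRatio]; ring
  · have hprod : Integrable (fun p : ℝ × ℝ => (Real.Gamma σ * p.1 ^ (a - 1 - σ)) *
        p.2 ^ (s - 1 + σ)) unitSquare := by
      refine Integrable.mul_prod (f := fun q : ℝ => Real.Gamma σ * q ^ (a - 1 - σ))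
        (g := fun t : ℝ => t ^ (s - 1 + σ)) ?_ ?_
      · exact ((intervalIntegral.integrableOn_Ioo_rpow_iff one_pos).2 (by linarith)).const_mul _
      · exact (intervalIntegral.integrableOn_Ioo_rpow_iff one_pos).2 (by linarith)
    refine hprod.congr ?_
    filter_upwards [ae_unitSquare] with p hp
    have hq := hp.1.1
    have ht := hp.2.1
    have h1 : ∫ x in Set.Ioi (0 : ℝ), ‖x ^ (σ - 1) * expRatio a s x p‖
        = ∫ x in Set.Ioi (0 : ℝ), (p.1 ^ (a - 1) * p.2 ^ (s - 1)) *
          (x ^ (σ - 1) * Real.exp (-(p.1 / p.2 * x))) := by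
      refine setIntegral_congr_fun measurableSet_Ioi fun x hx => ?_
      have hx : 0 < x := hx
      rw [Real.norm_of_nonneg (by unfold expRatio; positivity)]
      simp only [expRatio]; ring
    rw [h1, integral_const_mul, Real.integral_rpow_mul_exp_neg_mul_Ioi h0 (div_pos hq ht),
      one_div_div, Real.div_rpow ht.le hq.le, Real.rpow_sub hq, Real.rpow_add ht]
    field_simp

theorem integrable_expRatio_mono {a s x y : ℝ} (hxy : x ≤ y)
    (h : Integrable (expRatio a s x) unitSquare) : Integrable (expRatio a s y) unitSquare := by
  refine h.mono' ((measurable_expRatio a s).comp measurable_prodMk_left).aestronglyMeasurable ?_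
  filter_upwards [ae_unitSquare] with p hp
  have hq := hp.1.1
  have ht := hp.2.1
  rw [Real.norm_of_nonneg (by unfold expRatio; positivity)]
  unfold expRatio
  gcongr

/-- For `s ≤ 0` the factor `t^(s-1)` alone is not integrable, so the exponential has to help. Fubini
gives integrability for almost every `y`, hence for some `y` in `(0, x)`, and the integrand
decreases in its parameter. -/
theorem integrable_expRatio {a s σ x : ℝ} (h0 : 0 < σ) (hs : 0 < s + σ) (ha : σ < a)
    (hx : 0 < x) : Integrable (expRatio a s x) unitSquare := by
  have h1 := (integrable_expRatio_prod h0 hs ha).prod_right_ae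
  rw [ae_restrict_iff' measurableSet_Ioi] at h1
  have h2 : ∃ y ∈ Set.Ioo 0 x, y ∈ Set.Ioi (0 : ℝ) →
      Integrable (fun p => y ^ (σ - 1) * expRatio a s y p) unitSquare := by
    by_contra! hcon
    have h3 : volume (Set.Ioo 0 x) = 0 := measure_mono_null (fun y hy => by
      have := hcon y hy
      simpa using this) h1
    simp at h3; linarith
  obtain ⟨y, hy, h3⟩ := h2
  have h4 := (h3 hy.1).const_mul ((y ^ (σ - 1))⁻¹)
  have h5 : y ^ (σ - 1) ≠ 0 := (Real.rpow_pos_of_pos hy.1 _).ne'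
  refine integrable_expRatio_mono hy.2.le (h4.congr (Filter.Eventually.of_forall fun p => ?_))
  simp only; rw [inv_mul_cancel_left₀ h5]

theorem continuousAt_expRatioIntegral {a s σ x : ℝ} (h0 : 0 < σ) (hs : 0 < s + σ) (ha : σ < a)
    (hx : 0 < x) : ContinuousAt (expRatioIntegral a s) x := by
  unfold expRatioIntegral
  refine continuousAt_of_dominated (bound := expRatio a s (x / 2)) ?_ ?_
    (integrable_expRatio h0 hs ha (half_pos hx)) ?_
  · exact Filter.Eventually.of_forall fun y =>
      ((measurable_expRatio a s).comp measurable_prodMk_left).aestronglyMeasurable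
  · filter_upwards [lt_mem_nhds (half_lt_self hx)] with y hy
    filter_upwards [ae_unitSquare] with p hp
    have hq := hp.1.1
    have ht := hp.2.1
    rw [Real.norm_of_nonneg (by unfold expRatio; positivity)]
    unfold expRatio
    gcongr
  · refine Filter.Eventually.of_forall fun p => ?_
    unfold expRatio
    fun_prop

theorem integrable_cpow_mul_expRatio {a s σ : ℝ} (h0 : 0 < σ) (hs : 0 < s + σ) (ha : σ < a)
    {w : ℂ} (hw : w.re = σ) :
    Integrable (fun z : ℝ × (ℝ × ℝ) => (z.1 : ℂ) ^ (w - 1) * (expRatio a s z.1 z.2 : ℂ))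
      ((volume.restrict (Set.Ioi 0)).prod unitSquare) := by
  refine (integrable_expRatio_prod h0 hs ha).mono' ?_ ?_
  · have := measurable_expRatio a s
    exact (((Complex.measurable_ofReal.comp measurable_fst).pow_const _).mul
      (Complex.measurable_ofReal.comp this)).aestronglyMeasurable
  · have h1 : ∀ᵐ z ∂((volume.restrict (Set.Ioi (0:ℝ))).prod unitSquare),
        z.1 ∈ Set.Ioi (0:ℝ) ∧ z.2.1 ∈ Set.Ioo (0 : ℝ) 1 ∧ z.2.2 ∈ Set.Ioo (0 : ℝ) 1 := by
      unfold unitSquare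
      rw [Measure.prod_restrict, Measure.prod_restrict]
      exact ae_restrict_mem (measurableSet_Ioi.prod (measurableSet_Ioo.prod measurableSet_Ioo))
    filter_upwards [h1] with z hz
    obtain ⟨hx, ⟨hq, -⟩, ⟨ht, -⟩⟩ := hz
    have hx : 0 < z.1 := hx
    rw [norm_mul, Complex.norm_cpow_eq_rpow_re_of_pos hx, Complex.norm_real,
      Real.norm_of_nonneg (by unfold expRatio; positivity)]
    simp [hw]

theorem mellinConvergent_expRatioIntegral {a s σ : ℝ} (h0 : 0 < σ) (hs : 0 < s + σ) (ha : σ < a)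
    {w : ℂ} (hw : w.re = σ) :
    MellinConvergent (fun x => (expRatioIntegral a s x : ℂ)) w := by
  have := (integrable_cpow_mul_expRatio h0 hs ha hw).integral_prod_left
  refine this.congr (Filter.Eventually.of_forall fun x => ?_)
  simp only [smul_eq_mul]
  rw [integral_const_mul, integral_complex_ofReal]
  rfl

/-- After exchanging integrals, the `x`-integral is the Gamma integral `Γ(w) (q/t)^(-w)`, and two
power integrals over `(0, 1)` remain. -/
theorem mellin_expRatioIntegral {a s σ : ℝ} (h0 : 0 < σ) (hs : 0 < s + σ) (ha : σ < a)
    {w : ℂ} (hw : w.re = σ) :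
    mellin (fun x => (expRatioIntegral a s x : ℂ)) w =
      Complex.Gamma w * (1 / (a - w)) * (1 / (s + w)) := by
  have h1 : mellin (fun x => (expRatioIntegral a s x : ℂ)) w =
      ∫ x in Set.Ioi (0:ℝ), ∫ p, (x : ℂ) ^ (w - 1) * (expRatio a s x p : ℂ) ∂unitSquare := by
    unfold mellin
    congr 1 with x
    rw [integral_const_mul, integral_complex_ofReal]
    rfl
  rw [h1, integral_integral_swap (integrable_cpow_mul_expRatio h0 hs ha hw)]
  have h2 : ∀ᵐ p ∂unitSquare,
      ∫ x in Set.Ioi (0:ℝ), (x : ℂ) ^ (w - 1) * (expRatio a s x p : ℂ) =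
        (Complex.Gamma w * (((p.1 ^ (a - 1) : ℝ) : ℂ) * (p.1 : ℂ) ^ (-w))) *
          (((p.2 ^ (s - 1) : ℝ) : ℂ) * (p.2 : ℂ) ^ w) := by
    filter_upwards [ae_unitSquare] with p hp
    have hq := hp.1.1
    have ht := hp.2.1
    have h3 : ∀ x : ℝ, (x : ℂ) ^ (w - 1) * (expRatio a s x p : ℂ) =
        (((p.1 ^ (a - 1) : ℝ) : ℂ) * ((p.2 ^ (s - 1) : ℝ) : ℂ)) *
          ((x : ℂ) ^ (w - 1) * Complex.exp (-(((p.1 / p.2 : ℝ) : ℂ) * x))) := by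
      intro x
      unfold expRatio
      push_cast
      ring
    simp_rw [h3]
    rw [integral_const_mul, Complex.integral_cpow_mul_exp_neg_mul_Ioi (by rw [hw]; exact h0)
      (div_pos hq ht)]
    have h4 : (1 / ((p.1 / p.2 : ℝ) : ℂ)) = ((p.2 : ℝ) : ℂ) * ((p.1⁻¹ : ℝ) : ℂ) := by
      push_cast; field_simp
    rw [h4, Complex.mul_cpow_ofReal_nonneg ht.le (inv_pos.2 hq).le, Complex.ofReal_inv,
      Complex.inv_cpow _ _ (by rw [Complex.arg_ofReal_of_nonneg hq.le]; exact Real.pi_pos.ne),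
      Complex.cpow_neg]
    ring
  rw [integral_congr_ae h2]
  unfold unitSquare
  rw [integral_prod_mul (fun q : ℝ => Complex.Gamma w * (((q ^ (a - 1) : ℝ) : ℂ) * (q : ℂ) ^ (-w)))
    (fun t : ℝ => ((t ^ (s - 1) : ℝ) : ℂ) * (t : ℂ) ^ w), integral_const_mul,
    integral_Ioo_rpow_mul_cpow (by simp [hw]; linarith),
    integral_Ioo_rpow_mul_cpow (by rw [hw]; linarith)]
  ring_nf

theorem norm_Gamma_le {w : ℂ} (hw : 0 < w.re) : ‖Complex.Gamma w‖ ≤ Real.Gamma w.re := by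
  rw [Complex.Gamma_eq_integral hw, Real.Gamma_eq_integral hw, Complex.GammaIntegral]
  refine (norm_integral_le_integral_norm _).trans (le_of_eq ?_)
  refine setIntegral_congr_fun measurableSet_Ioi fun x hx => ?_
  rw [norm_mul, Complex.norm_cpow_eq_rpow_re_of_pos hx, Complex.norm_real,
    Real.norm_of_nonneg (Real.exp_pos _).le]
  simp

theorem inv_sq_add_sq_le {r : ℝ} (hr : r ≠ 0) (y : ℝ) :
    (r ^ 2 + y ^ 2)⁻¹ ≤ (max 1 (r ^ 2)⁻¹) * (1 + y ^ 2)⁻¹ := by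
  have h2 : 0 < r ^ 2 := by positivity
  rw [← div_eq_mul_inv, le_div_iff₀ (by positivity), ← div_eq_inv_mul, div_le_iff₀ (by positivity)]
  have h3 : 1 ≤ max 1 (r ^ 2)⁻¹ := le_max_left _ _
  have h4 : (r ^ 2)⁻¹ ≤ max 1 (r ^ 2)⁻¹ := le_max_right _ _
  have h5 : 1 ≤ max 1 (r ^ 2)⁻¹ * r ^ 2 := by
    calc 1 = (r ^ 2)⁻¹ * r ^ 2 := (inv_mul_cancel₀ h2.ne').symm
      _ ≤ _ := by gcongr
  nlinarith [sq_nonneg y]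

theorem integrable_inv_sq_add_sq {r : ℝ} (hr : r ≠ 0) :
    Integrable fun y : ℝ => (r ^ 2 + y ^ 2)⁻¹ := by
  refine (integrable_inv_one_add_sq.const_mul (max 1 (r ^ 2)⁻¹)).mono' ?_
    (Filter.Eventually.of_forall fun y => ?_)
  · exact Measurable.aestronglyMeasurable (by fun_prop)
  · rw [Real.norm_of_nonneg (by positivity)]
    exact inv_sq_add_sq_le hr y

/-- No decay of `Γ` on vertical lines is needed: `|Γ(w)| ≤ Γ(Re w)`, and the two rational factors
together decay like `y^(-2)`. -/
theorem verticalIntegrable_mellin_expRatioIntegral {a s σ : ℝ} (h0 : 0 < σ) (hs : 0 < s + σ)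
    (ha : σ < a) :
    Complex.VerticalIntegrable (mellin fun x => (expRatioIntegral a s x : ℂ)) σ := by
  have h1 : (fun y : ℝ => mellin (fun x => (expRatioIntegral a s x : ℂ)) (σ + y * Complex.I)) =
      fun y : ℝ => Complex.Gamma (σ + y * Complex.I) * (1 / (a - (σ + y * Complex.I))) *
        (1 / (s + (σ + y * Complex.I))) := by
    ext y
    exact mellin_expRatioIntegral h0 hs ha (by simp)
  unfold Complex.VerticalIntegrable
  rw [h1]
  have hne1 : ∀ y : ℝ, (a : ℂ) - (σ + y * Complex.I) ≠ 0 := fun y h => by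
    have := congrArg Complex.re h
    simp at this; linarith
  have hne2 : ∀ y : ℝ, (s : ℂ) + (σ + y * Complex.I) ≠ 0 := fun y h => by
    have := congrArg Complex.re h
    simp at this; linarith
  refine ((((integrable_inv_sq_add_sq (sub_pos.2 ha).ne').add
    (integrable_inv_sq_add_sq hs.ne'))).const_mul (Real.Gamma σ)).mono' ?_ ?_
  · refine Continuous.aestronglyMeasurable ?_
    have hG : Continuous fun y : ℝ => Complex.Gamma (σ + y * Complex.I) := by
      rw [continuous_iff_continuousAt]
      intro y
      have h2 : ContinuousAt Complex.Gamma ((σ : ℂ) + y * Complex.I) := by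
        refine (Complex.differentiableAt_Gamma _ fun m hm => ?_).continuousAt
        have := congrArg Complex.re hm
        simp at this
        have h3 : (0 : ℝ) ≤ m := Nat.cast_nonneg m
        linarith
      exact ContinuousAt.comp (f := fun y : ℝ => (σ : ℂ) + y * Complex.I) h2 (by fun_prop)
    refine (hG.mul (Continuous.div continuous_const (by fun_prop) hne1)).mul
      (Continuous.div continuous_const (by fun_prop) hne2)
  · refine Filter.Eventually.of_forall fun y => ?_
    have hn : ‖Complex.Gamma (σ + y * Complex.I)‖ ≤ Real.Gamma σ := by
      have := norm_Gamma_le (w := σ + y * Complex.I) (by simpa using h0)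
      simpa using this
    have e1 : ‖1 / ((a : ℂ) - (σ + y * Complex.I))‖ ^ 2 = ((a - σ) ^ 2 + y ^ 2)⁻¹ := by
      rw [norm_div, div_pow, Complex.sq_norm, Complex.sq_norm, Complex.normSq_apply,
        Complex.normSq_apply]
      simp
      ring
    have e2 : ‖1 / ((s : ℂ) + (σ + y * Complex.I))‖ ^ 2 = ((s + σ) ^ 2 + y ^ 2)⁻¹ := by
      rw [norm_div, div_pow, Complex.sq_norm, Complex.sq_norm, Complex.normSq_apply,
        Complex.normSq_apply]
      simp
      ring
    rw [norm_mul, norm_mul, mul_assoc]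
    simp only [Pi.add_apply]
    rw [← e1, ← e2]
    refine mul_le_mul hn ?_ (by positivity) (Real.Gamma_pos_of_pos h0).le
    -- The product of the two norms is at most the sum of their squares.
    nlinarith [sq_nonneg (‖1 / ((a : ℂ) - (σ + y * Complex.I))‖ -
      ‖1 / ((s : ℂ) + (σ + y * Complex.I))‖),
      sq_nonneg ‖1 / ((a : ℂ) - (σ + y * Complex.I))‖,
      sq_nonneg ‖1 / ((s : ℂ) + (σ + y * Complex.I))‖]

/-- The Meijer function `G^{2,1}_{2,3}[x | 1-a, s+1; s, 0, -a]` as a real double integral. -/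
theorem meijerG_eq_expRatioIntegral {a s x : ℝ} (hx : 0 < x)
    (h : ∃ c, MeijerSeparates 2 1 (![1 - (a : ℂ), (s : ℂ) + 1] : Fin 2 → ℂ)
      (![(s : ℂ), 0, -(a : ℂ)] : Fin 3 → ℂ) c) :
    meijerG 2 1 (![1 - (a : ℂ), (s : ℂ) + 1] : Fin 2 → ℂ)
      (![(s : ℂ), 0, -(a : ℂ)] : Fin 3 → ℂ) (x : ℂ) = (expRatioIntegral a s x : ℂ) := by
  unfold meijerG
  rw [dif_pos h]
  have hc := h.choose_spec
  set c := h.choose with hcdef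
  obtain ⟨hc1, hc2⟩ := hc
  have k1 : c < s := by simpa using hc1 0 (by decide)
  have k2 : c < 0 := by simpa using hc1 1 (by decide)
  have k3 : -a < c := by simpa using hc2 0 (by decide)
  -- A separating abscissa `c` for the Meijer contour is exactly one for which `σ = -c` lies in the
  -- strip of the Mellin transform.
  have h0 : 0 < -c := by linarith
  have hs : 0 < s + -c := by linarith
  have ha : -c < a := by linarith
  have hinv := mellinInv_mellin_eq (-c) (fun x => (expRatioIntegral a s x : ℂ)) hx
    (mellinConvergent_expRatioIntegral h0 hs ha (by simp))
    (verticalIntegrable_mellin_expRatioIntegral h0 hs ha)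
    (Complex.continuous_ofReal.continuousAt.comp (continuousAt_expRatioIntegral h0 hs ha hx))
  -- The Meijer integrand carries `z^s` and the inversion formula `x^(-w)`, so the two variables are
  -- negatives of each other and the line has to be reflected.
  rw [← hinv, mellinInv, ← integral_neg_eq_self]
  rw [Complex.real_smul]
  push_cast
  congr 1
  refine integral_congr_ae (Filter.Eventually.of_forall fun y => ?_)
  simp only
  rw [mellin_expRatioIntegral h0 hs ha (by simp), smul_eq_mul]
  -- The rational factors of the Mellin transform become the Gamma quotients of the Meijer
  -- integrand; the separation conditions give positive real parts.
  have g1 : ∀ z : ℂ, 0 < z.re → Complex.Gamma z * (Complex.Gamma (z + 1))⁻¹ = z⁻¹ := by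
    intro z hz
    have hz0 : z ≠ 0 := fun h => by simp [h] at hz
    rw [Complex.Gamma_add_one z hz0]
    have := Complex.Gamma_ne_zero_of_re_pos hz
    field_simp
  have e1 := g1 ((s : ℂ) - (c - y * Complex.I)) (by simp; linarith)
  have e2 := g1 ((a : ℂ) + (c - y * Complex.I)) (by simp; linarith)
  unfold meijerIntegrand
  simp only [Fin.prod_univ_three, Fin.prod_univ_two, Matrix.cons_val_zero, Matrix.cons_val_one,
    Matrix.cons_val, Fin.val_zero, Fin.val_one, Fin.val_two]
  norm_num
  rw [show (s : ℂ) + (-(c : ℂ) + y * Complex.I) = s - (c - y * Complex.I) by ring,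
    show (a : ℂ) - (-(c : ℂ) + y * Complex.I) = a + (c - y * Complex.I) by ring,
    ← e1, ← e2,
    show (c : ℂ) + -(y * Complex.I) = c - y * Complex.I by ring,
    show -(y * Complex.I) + (c : ℂ) = c - y * Complex.I by ring,
    show -(c : ℂ) + y * Complex.I = y * Complex.I - c by ring,
    show (y * Complex.I) + -(c : ℂ) = y * Complex.I - c by ring,
    show (s : ℂ) + 1 - (c - y * Complex.I) = s - (c - y * Complex.I) + 1 by ring,
    show 1 + (a : ℂ) + (c - y * Complex.I) = a + (c - y * Complex.I) + 1 by ring]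
  ring

theorem integral_Ioo_rpow_mul_exp_neg_div {s P : ℝ} (hP : 0 < P) (y : ℝ) :
    ∫ τ in Set.Ioo 0 P, τ ^ (s - 1) * Real.exp (-(y / τ)) =
      P ^ s * ∫ t in Set.Ioo (0 : ℝ) 1, t ^ (s - 1) * Real.exp (-(y / P / t)) := by
  have himg : (fun t : ℝ => P * t) '' Set.Ioo 0 1 = Set.Ioo 0 P := by
    rw [Set.image_mul_left_Ioo hP]; simp
  rw [← himg, integral_image_eq_integral_abs_deriv_smul (f' := fun _ => P) measurableSet_Ioo
    (fun x _ => by simpa using ((hasDerivAt_id x).const_mul P).hasDerivWithinAt)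
    (fun x _ y _ h => mul_left_cancel₀ hP.ne' h), ← integral_const_mul]
  refine setIntegral_congr_fun measurableSet_Ioo fun t ht => ?_
  have ht0 := ht.1
  simp only [smul_eq_mul, abs_of_pos hP]
  rw [Real.mul_rpow hP.le ht0.le, Real.rpow_sub_one hP.ne', div_div]
  field_simp

theorem expRatioIntegral_eq_iterated {a s σ x : ℝ} (h0 : 0 < σ) (hs : 0 < s + σ) (ha : σ < a)
    (hx : 0 < x) :
    expRatioIntegral a s x = ∫ q in Set.Ioo (0 : ℝ) 1, q ^ (a - 1) *
      ∫ t in Set.Ioo (0 : ℝ) 1, t ^ (s - 1) * Real.exp (-(q * x / t)) := by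
  unfold expRatioIntegral
  have hi := integrable_expRatio h0 hs ha hx
  unfold unitSquare at hi ⊢
  rw [integral_prod _ hi]
  congr 1 with q
  rw [← integral_const_mul]
  congr 1 with t
  unfold expRatio
  rw [mul_assoc, div_mul_eq_mul_div]

/-- The double integral in the variables `r = v² q^(2/ν)`, `τ = P t`. -/
theorem rpow_mul_expRatioIntegral {a s σ c P ν v : ℝ} (h0 : 0 < σ) (hs : 0 < s + σ) (ha : σ < a)
    (hc : 0 < c) (hP : 0 < P) (hν : 0 < ν) (hv : 0 < v) :
    P ^ s * v ^ (ν * a) * expRatioIntegral a s (c * v ^ ν / P) =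
      ν / 2 * ∫ r in Set.Ioo 0 (v ^ 2), r ^ (ν * a / 2 - 1) *
        ∫ τ in Set.Ioo 0 P, τ ^ (s - 1) * Real.exp (-(c * r ^ (ν / 2) / τ)) := by
  have himg : (fun q : ℝ => v ^ 2 * q ^ (2 / ν)) '' Set.Ioo 0 1 = Set.Ioo 0 (v ^ 2) := by
    ext r
    constructor
    · rintro ⟨q, hq, rfl⟩
      have h1 : 0 < q ^ (2 / ν) := Real.rpow_pos_of_pos hq.1 _
      have h2 : q ^ (2 / ν) < 1 := Real.rpow_lt_one hq.1.le hq.2 (by positivity)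
      exact ⟨by positivity, by nlinarith [pow_pos hv 2]⟩
    · intro hr
      have h1 : 0 < r / v ^ 2 := div_pos hr.1 (by positivity)
      refine ⟨(r / v ^ 2) ^ (ν / 2), ⟨by positivity, Real.rpow_lt_one h1.le
        ((div_lt_one (by positivity)).2 hr.2) (by positivity)⟩, ?_⟩
      simp only
      rw [← Real.rpow_mul h1.le, show ν / 2 * (2 / ν) = 1 by field_simp, Real.rpow_one]
      field_simp
  have hinj : Set.InjOn (fun q : ℝ => v ^ 2 * q ^ (2 / ν)) (Set.Ioo 0 1) := by
    intro x hx y hy h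
    have h1 : x ^ (2 / ν) = y ^ (2 / ν) := mul_left_cancel₀ (by positivity) h
    exact (Real.rpow_left_inj hx.1.le hy.1.le (by positivity)).1 h1
  rw [← himg, integral_image_eq_integral_abs_deriv_smul
    (f' := fun q => v ^ 2 * (2 / ν * q ^ (2 / ν - 1))) measurableSet_Ioo
    (fun q hq => ((Real.hasDerivAt_rpow_const (Or.inl hq.1.ne')).const_mul _).hasDerivWithinAt)
    hinj, expRatioIntegral_eq_iterated h0 hs ha (by positivity), ← integral_const_mul,
    ← integral_const_mul]
  refine setIntegral_congr_fun measurableSet_Ioo fun q hq => ?_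
  have hq0 := hq.1
  have e1 : (v ^ 2 * q ^ (2 / ν)) ^ (ν / 2) = v ^ ν * q := by
    rw [Real.mul_rpow (by positivity) (by positivity), ← Real.rpow_mul hq0.le,
      show 2 / ν * (ν / 2) = 1 by field_simp, Real.rpow_one, ← Real.rpow_natCast,
      ← Real.rpow_mul hv.le]
    congr 2; push_cast; ring
  -- The exponent `ν a/2 - 1` of `r` is the one that, together with the Jacobian, leaves `q^(a-1)`.
  have e2 : (v ^ 2 * q ^ (2 / ν)) ^ (ν * a / 2 - 1) * (v ^ 2 * q ^ (2 / ν - 1)) =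
      v ^ (ν * a) * q ^ (a - 1) := by
    rw [Real.mul_rpow (by positivity) (by positivity), ← Real.rpow_mul hq0.le,
      ← Real.rpow_natCast v 2, ← Real.rpow_mul hv.le, mul_mul_mul_comm, ← Real.rpow_add hv,
      ← Real.rpow_add hq0]
    congr 2
    · push_cast; ring
    · field_simp; ring
  simp only [smul_eq_mul]
  rw [abs_of_pos (by positivity), e1, integral_Ioo_rpow_mul_exp_neg_div hP]
  have e3 : c * (v ^ ν * q) / P = q * (c * v ^ ν / P) := by ring
  rw [e3]
  generalize ∫ t in Set.Ioo (0 : ℝ) 1, t ^ (s - 1) * Real.exp (-(q * (c * v ^ ν / P) / t)) = I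
  calc P ^ s * v ^ (ν * a) * (q ^ (a - 1) * I)
      = (v ^ (ν * a) * q ^ (a - 1)) * (P ^ s * I) := by ring
    _ = _ := by rw [← e2]; field_simp

/-! ## Laws of the squared distances -/

/-- Negative `s` is allowed, with an empty disc on the left and a truncated value on the right, so
that distribution functions can be computed without splitting cases. -/
theorem volume_euclidean_disc_le (s : ℝ) :
    volume {x : EuclideanSpace ℝ (Fin 2) | x 0 ^ 2 + x 1 ^ 2 ≤ s} =
      ENNReal.ofReal (Real.pi * s) := by
  rcases lt_or_ge s 0 with hs | hs
  · rw [ENNReal.ofReal_of_nonpos (by nlinarith [Real.pi_pos])]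
    convert! measure_empty (μ := (volume : Measure (EuclideanSpace ℝ (Fin 2))))
    ext x
    simp only [Set.mem_ofPred_eq, Set.mem_empty_iff_false, iff_false, not_le]
    nlinarith [sq_nonneg (x 0), sq_nonneg (x 1)]
  · have : {x : EuclideanSpace ℝ (Fin 2) | x 0 ^ 2 + x 1 ^ 2 ≤ s} =
        Metric.closedBall 0 (Real.sqrt s) := by
      ext x
      simp only [Set.mem_ofPred_eq, mem_closedBall_zero_iff]
      rw [Real.le_sqrt (norm_nonneg _) hs, EuclideanSpace.norm_sq_eq]
      simp [Fin.sum_univ_two]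
    rw [this, EuclideanSpace.volume_closedBall_fin_two, ← ENNReal.ofReal_pow (Real.sqrt_nonneg _),
      Real.sq_sqrt hs, ← ENNReal.ofReal_mul hs, mul_comm]

theorem volume_euclidean_disc_lt (s : ℝ) :
    volume {x : EuclideanSpace ℝ (Fin 2) | x 0 ^ 2 + x 1 ^ 2 < s} =
      ENNReal.ofReal (Real.pi * s) := by
  rcases lt_or_ge s 0 with hs | hs
  · rw [ENNReal.ofReal_of_nonpos (by nlinarith [Real.pi_pos])]
    convert! measure_empty (μ := (volume : Measure (EuclideanSpace ℝ (Fin 2))))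
    ext x
    simp only [Set.mem_ofPred_eq, Set.mem_empty_iff_false, iff_false, not_lt]
    nlinarith [sq_nonneg (x 0), sq_nonneg (x 1)]
  · have : {x : EuclideanSpace ℝ (Fin 2) | x 0 ^ 2 + x 1 ^ 2 < s} =
        Metric.ball 0 (Real.sqrt s) := by
      ext x
      simp only [Set.mem_ofPred_eq, mem_ball_zero_iff]
      rw [Real.lt_sqrt (norm_nonneg _), EuclideanSpace.norm_sq_eq]
      simp [Fin.sum_univ_two]
    rw [this, EuclideanSpace.volume_ball_fin_two, ← ENNReal.ofReal_pow (Real.sqrt_nonneg _),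
      Real.sq_sqrt hs, ← ENNReal.ofReal_mul hs, mul_comm]

theorem volume_pi_disc_le (s : ℝ) :
    volume {y : Fin 2 → ℝ | y 0 ^ 2 + y 1 ^ 2 ≤ s} = ENNReal.ofReal (Real.pi * s) := by
  rw [← volume_euclidean_disc_le, ← (PiLp.volume_preserving_ofLp (Fin 2)).measure_preimage]
  · rfl
  · exact (measurableSet_le (by fun_prop) measurable_const).nullMeasurableSet

theorem volume_pi_disc_lt (s : ℝ) :
    volume {y : Fin 2 → ℝ | y 0 ^ 2 + y 1 ^ 2 < s} = ENNReal.ofReal (Real.pi * s) := by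
  rw [← volume_euclidean_disc_lt, ← (PiLp.volume_preserving_ofLp (Fin 2)).measure_preimage]
  · rfl
  · exact (measurableSet_lt (by fun_prop) measurable_const).nullMeasurableSet

/-- The intersection of the open unit ball with the solid cone `t |x| ≤ x_2`, `x ≠ 0`. -/
def solidCone (t : ℝ) : Set (ℝ × (Fin 2 → ℝ)) :=
  {q | q.1 ^ 2 + (q.2 0 ^ 2 + q.2 1 ^ 2) < 1 ∧ 0 < q.1 ∧
    t ^ 2 * (q.1 ^ 2 + (q.2 0 ^ 2 + q.2 1 ^ 2)) ≤ q.1 ^ 2}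

theorem measurableSet_solidCone (t : ℝ) : MeasurableSet (solidCone t) := by
  have h : solidCone t = {q | q.1 ^ 2 + (q.2 0 ^ 2 + q.2 1 ^ 2) < 1} ∩ ({q | 0 < q.1} ∩
      {q | t ^ 2 * (q.1 ^ 2 + (q.2 0 ^ 2 + q.2 1 ^ 2)) ≤ q.1 ^ 2}) := rfl
  rw [h]
  exact   (measurableSet_lt (by fun_prop) measurable_const).inter
    ((measurableSet_lt measurable_const (by fun_prop)).inter
      (measurableSet_le (by fun_prop) (by fun_prop)))

/-- Horizontal slices are discs. Below height `t` the cone is the binding constraint, above it the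
ball; the two integrals add up to `2π(1-t)/3`. -/
theorem volume_solidCone {t : ℝ} (ht : 0 < t) (ht1 : t ≤ 1) :
    volume (solidCone t) = ENNReal.ofReal (2 * Real.pi * (1 - t) / 3) := by
  rw [Measure.volume_eq_prod, Measure.prod_apply (measurableSet_solidCone t)]
  have hsec : ∀ z : ℝ, volume (Prod.mk z ⁻¹' solidCone t) =
      (Set.Ioo 0 t).indicator (fun z => ENNReal.ofReal (Real.pi * ((1 - t ^ 2) / t ^ 2 * z ^ 2))) z +
      (Set.Ico t 1).indicator (fun z => ENNReal.ofReal (Real.pi * (1 - z ^ 2))) z := by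
    intro z
    by_cases hz0 : 0 < z
    swap
    · rw [Set.indicator_of_notMem (fun h => hz0 h.1),
        Set.indicator_of_notMem (fun h => hz0 (ht.trans_le h.1)), add_zero]
      convert! measure_empty (μ := (volume : Measure (Fin 2 → ℝ)))
      ext y
      simp [solidCone, hz0]
    rcases lt_or_ge z t with hzt | hzt
    · rw [Set.indicator_of_mem (Set.mem_Ioo.2 ⟨hz0, hzt⟩), Set.indicator_of_notMem (fun h => hzt.not_ge h.1),
        add_zero, ← volume_pi_disc_le]
      congr 1
      ext y
      simp only [solidCone, Set.mem_preimage, Set.mem_ofPred_eq]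
      rw [div_mul_eq_mul_div, le_div_iff₀ (by positivity)]
      constructor
      · rintro ⟨-, -, h⟩; linarith
      · intro h
        refine ⟨?_, hz0, by linarith⟩
        have h1 : z ^ 2 < t ^ 2 := by gcongr
        have h2 : (z ^ 2 + (y 0 ^ 2 + y 1 ^ 2)) * t ^ 2 < 1 * t ^ 2 := by linarith
        exact lt_of_mul_lt_mul_right h2 (by positivity)
    · rw [Set.indicator_of_notMem (fun h => hzt.not_gt h.2), zero_add]
      have hset : (Prod.mk z ⁻¹' solidCone t) = {y : Fin 2 → ℝ | y 0 ^ 2 + y 1 ^ 2 < 1 - z ^ 2} := by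
        ext y
        simp only [solidCone, Set.mem_preimage, Set.mem_ofPred_eq]
        constructor
        · rintro ⟨h, -, -⟩; linarith
        · intro h
          refine ⟨by linarith, hz0, ?_⟩
          have h1 : t ^ 2 ≤ z ^ 2 := by gcongr
          have h3 : 0 < t ^ 2 := by positivity
          nlinarith
      rw [hset, volume_pi_disc_lt]
      rcases lt_or_ge z 1 with hz1 | hz1
      · rw [Set.indicator_of_mem (Set.mem_Ico.2 ⟨hzt, hz1⟩)]
      · rw [Set.indicator_of_notMem (fun h => hz1.not_gt h.2), ENNReal.ofReal_of_nonpos]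
        exact mul_nonpos_of_nonneg_of_nonpos Real.pi_pos.le (by nlinarith)
  simp_rw [hsec]
  have ht2 : 0 ≤ 1 - t ^ 2 := by nlinarith
  rw [lintegral_add_left (Measurable.indicator (by fun_prop) measurableSet_Ioo),
    lintegral_indicator measurableSet_Ioo, lintegral_indicator measurableSet_Ico]
  have i1 : IntegrableOn (fun z : ℝ => Real.pi * ((1 - t ^ 2) / t ^ 2 * z ^ 2)) (Set.Ioo 0 t) :=
    (Continuous.integrableOn_Icc (by fun_prop)).mono_set Set.Ioo_subset_Icc_self
  have i2 : IntegrableOn (fun z : ℝ => Real.pi * (1 - z ^ 2)) (Set.Ico t 1) :=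
    (Continuous.integrableOn_Icc (by fun_prop)).mono_set Set.Ico_subset_Icc_self
  have n1 : 0 ≤ᵐ[volume.restrict (Set.Ioo 0 t)]
      fun z : ℝ => Real.pi * ((1 - t ^ 2) / t ^ 2 * z ^ 2) :=
    Filter.Eventually.of_forall fun z => by simp only [Pi.zero_apply]; positivity
  have n2 : 0 ≤ᵐ[volume.restrict (Set.Ico t 1)] fun z : ℝ => Real.pi * (1 - z ^ 2) := by
    filter_upwards [ae_restrict_mem measurableSet_Ico] with z hz
    have : z ^ 2 ≤ 1 := by nlinarith [hz.1, hz.2]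
    simp only [Pi.zero_apply]
    exact mul_nonneg Real.pi_pos.le (by linarith)
  rw [← ofReal_integral_eq_lintegral_ofReal i1 n1, ← ofReal_integral_eq_lintegral_ofReal i2 n2,
    ← ENNReal.ofReal_add (integral_nonneg_of_ae n1) (integral_nonneg_of_ae n2),
    ← integral_Ioc_eq_integral_Ioo, integral_Ico_eq_integral_Ioo, ← integral_Ioc_eq_integral_Ioo,
    ← intervalIntegral.integral_of_le ht.le, ← intervalIntegral.integral_of_le ht1]
  congr 1
  rw [intervalIntegral.integral_const_mul, intervalIntegral.integral_const_mul,
    intervalIntegral.integral_const_mul, intervalIntegral.integral_sub (by simp) (by simp)]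
  simp
  field_simp
  ring

/-- Splitting off the vertical coordinate preserves volume; as `t > 0`, the cone condition may be
squared provided the height is kept positive. -/
theorem volume_cone_ball {t : ℝ} (ht : 0 < t) (ht1 : t ≤ 1) :
    volume {x : EuclideanSpace ℝ (Fin 3) | ‖x‖ < 1 ∧ x ≠ 0 ∧ t * ‖x‖ ≤ x 2} =
      ENNReal.ofReal (2 * Real.pi * (1 - t) / 3) := by
  rw [← volume_solidCone ht ht1,
    ← (volume_preserving_piFinSuccAbove (fun _ : Fin 3 => ℝ) 2).measure_preimage
      (measurableSet_solidCone t).nullMeasurableSet,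
    ← (PiLp.volume_preserving_ofLp (Fin 3)).measure_preimage
      ((MeasurableEquiv.measurable _ (measurableSet_solidCone t))).nullMeasurableSet]
  congr 1
  ext x
  have hn : ‖x‖ ^ 2 = x 2 ^ 2 + (x 0 ^ 2 + x 1 ^ 2) := by
    rw [EuclideanSpace.norm_sq_eq, Fin.sum_univ_three]
    simp only [Real.norm_eq_abs, sq_abs]; ring
  have hx : x ∈ (WithLp.ofLp : EuclideanSpace ℝ (Fin 3) → _) ⁻¹'
      ((MeasurableEquiv.piFinSuccAbove (fun _ : Fin 3 => ℝ) 2) ⁻¹' solidCone t) ↔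
      (x 2 ^ 2 + (x 0 ^ 2 + x 1 ^ 2) < 1 ∧ 0 < x 2 ∧
        t ^ 2 * (x 2 ^ 2 + (x 0 ^ 2 + x 1 ^ 2)) ≤ x 2 ^ 2) := Iff.rfl
  rw [hx, ← hn, ← mul_pow]
  simp only [Set.mem_ofPred_eq]
  constructor
  · rintro ⟨h1, h2, h3⟩
    have h4 : 0 < ‖x‖ := norm_pos_iff.2 h2
    exact ⟨by nlinarith, lt_of_lt_of_le (by positivity) h3, by gcongr⟩
  · rintro ⟨h1, h2, h3⟩
    refine ⟨by nlinarith [norm_nonneg x], fun h => by simp [h] at h2, ?_⟩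
    exact (pow_le_pow_iff_left₀ (by positivity) h2.le two_ne_zero).1 h3

open scoped Pointwise in
/-- Archimedes' hat-box theorem: the area of a spherical cap is proportional to its height. -/
theorem toSphere_cap {t : ℝ} (ht : 0 < t) :
    (volume : Measure (EuclideanSpace ℝ (Fin 3))).toSphere
      {u | t ≤ (u : EuclideanSpace ℝ (Fin 3)) 2} = ENNReal.ofReal (2 * Real.pi * (1 - t)) := by
  have hmeas : MeasurableSet {u : Metric.sphere (0 : EuclideanSpace ℝ (Fin 3)) 1 |
      t ≤ (u : EuclideanSpace ℝ (Fin 3)) 2} :=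
    measurableSet_le measurable_const (by fun_prop)
  rcases lt_or_ge 1 t with ht1 | ht1
  · rw [ENNReal.ofReal_of_nonpos (by nlinarith [Real.pi_pos])]
    convert! measure_empty (μ := (volume : Measure (EuclideanSpace ℝ (Fin 3))).toSphere)
    ext u
    simp only [Set.mem_ofPred_eq, Set.mem_empty_iff_false, iff_false, not_le]
    have h1 := PiLp.norm_apply_le (u : EuclideanSpace ℝ (Fin 3)) 2
    rw [norm_eq_of_mem_sphere u, Real.norm_eq_abs] at h1
    exact (le_abs_self _).trans_lt (h1.trans_lt ht1)
  -- The surface measure of a set is the dimension, here 3, times the volume of the cone over it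
  -- inside the unit ball.
  · rw [Measure.toSphere_apply' _ hmeas]
    have hset : Set.Ioo (0 : ℝ) 1 • (Subtype.val '' {u : Metric.sphere (0 : EuclideanSpace ℝ (Fin 3)) 1 |
        t ≤ (u : EuclideanSpace ℝ (Fin 3)) 2}) =
        {x : EuclideanSpace ℝ (Fin 3) | ‖x‖ < 1 ∧ x ≠ 0 ∧ t * ‖x‖ ≤ x 2} := by
      ext x
      constructor
      · rintro ⟨r, hr, _, ⟨u, hu, rfl⟩, rfl⟩
        have hu1 := norm_eq_of_mem_sphere u
        have hr0 := hr.1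
        have hn : ‖r • (u : EuclideanSpace ℝ (Fin 3))‖ = r := by
          rw [norm_smul, hu1, mul_one, Real.norm_of_nonneg hr0.le]
        simp only [Set.mem_ofPred_eq] at hu ⊢
        rw [hn]
        refine ⟨hr.2, fun h => ?_, ?_⟩
        · rw [h, norm_zero] at hn; linarith
        · simp only [PiLp.smul_apply, smul_eq_mul]
          nlinarith
      · rintro ⟨h1, h2, h3⟩
        have h4 : 0 < ‖x‖ := norm_pos_iff.2 h2
        refine ⟨‖x‖, ⟨h4, h1⟩, ‖x‖⁻¹ • x, ⟨⟨‖x‖⁻¹ • x, by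
          simp [norm_smul, h4.ne']⟩, ?_, rfl⟩, ?_⟩
        · simp only [Set.mem_ofPred_eq, PiLp.smul_apply, smul_eq_mul]
          rw [← div_eq_inv_mul, le_div_iff₀ h4]
          exact h3
        · simp only
          rw [smul_smul, mul_inv_cancel₀ h4.ne', one_smul]
    rw [hset, volume_cone_ball ht ht1, finrank_euclideanSpace_fin, ← ENNReal.ofReal_natCast,
      ← ENNReal.ofReal_mul (by positivity)]
    congr 1
    push_cast; ring

/-- The uniform distribution on `[x, y]`. -/
def uniformIcc (x y : ℝ) : Measure ℝ :=
  ENNReal.ofReal (1 / (y - x)) • volume.restrict (Set.Icc x y)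

instance (x y : ℝ) : IsFiniteMeasure (uniformIcc x y) := by
  unfold uniformIcc
  exact Measure.smul_finite _ ENNReal.ofReal_ne_top

theorem uniformIcc_Iic (x y a : ℝ) :
    uniformIcc x y (Set.Iic a) = ENNReal.ofReal (1 / (y - x)) * ENNReal.ofReal (min y a - x) := by
  rw [uniformIcc, Measure.smul_apply, Measure.restrict_apply measurableSet_Iic, smul_eq_mul]
  congr 1
  rw [show Set.Iic a ∩ Set.Icc x y = Set.Icc x (min y a) by
    ext z; simp only [Set.mem_inter_iff, Set.mem_Iic, Set.mem_Icc, le_min_iff]; tauto,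
    Real.volume_Icc]

namespace Params

variable {p : Params}

theorem Valid.wER_pos (hp : p.Valid) : 0 < p.wER := add_pos hp.wE_pos hp.h0_pos

theorem Valid.wMax_sq (hp : p.Valid) : p.wMax ^ 2 = p.wMin ^ 2 + 2 * p.wER * p.wMin := by
  have := hp.wER_pos
  have := hp.wMin_pos
  exact Real.sq_sqrt (by positivity)

theorem dist_posR_sq (p : Params) (x : EuclideanSpace ℝ (Fin 3)) :
    dist x p.posR ^ 2 = x 0 ^ 2 + x 1 ^ 2 + (x 2 - p.wER) ^ 2 := by
  rw [EuclideanSpace.dist_eq, Real.sq_sqrt (by positivity), Fin.sum_univ_three]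
  simp [posR, Real.dist_eq, sq_abs]

/-- With `R = w_er + w_min`, a direction `u` gives squared distance `R² + w_er² - 2 R w_er u₂`,
affine in the height `u₂`, which the hat-box theorem makes uniform. The top `u₂ = 1` yields `w_min²`
and the rim `u₂ = w_er/R` yields `w_max²`. -/
theorem Valid.map_satelliteLaw (hp : p.Valid) :
    p.satelliteLaw.map (fun s => dist s p.posR ^ 2) = uniformIcc (p.wMin ^ 2) (p.wMax ^ 2) := by
  symm
  refine Measure.ext_of_Iic _ _ fun a => ?_
  have hw := hp.wER_pos
  have hm := hp.wMin_pos
  have hR : 0 < p.wER + p.wMin := by positivity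
  have hmeas : Measurable fun u : Metric.sphere (0 : EuclideanSpace ℝ (Fin 3)) 1 =>
      (p.wER + p.wMin) • (u : EuclideanSpace ℝ (Fin 3)) := by fun_prop
  have hmeas2 : Measurable fun s : EuclideanSpace ℝ (Fin 3) => dist s p.posR ^ 2 := by fun_prop
  rw [uniformIcc_Iic, Measure.map_apply hmeas2 measurableSet_Iic, satelliteLaw,
    Measure.map_apply hmeas (hmeas2 measurableSet_Iic)]
  have hcap : p.capDirections = {u : Metric.sphere (0 : EuclideanSpace ℝ (Fin 3)) 1 |
      p.wER / (p.wER + p.wMin) ≤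
      (u : EuclideanSpace ℝ (Fin 3)) 2} := by
    ext u
    simp only [capDirections, Set.mem_ofPred_eq]
    rw [div_le_iff₀' hR]
  have hcapm : MeasurableSet p.capDirections := by
    rw [hcap]; exact measurableSet_le measurable_const (by fun_prop)
  rw [cond_apply hcapm]
  -- The height at which the squared distance equals `a`.
  set ta := ((p.wER + p.wMin) ^ 2 + p.wER ^ 2 - a) / (2 * (p.wER + p.wMin) * p.wER) with hta
  have hint : p.capDirections ∩ ((fun u : Metric.sphere (0 : EuclideanSpace ℝ (Fin 3)) 1 =>
      (p.wER + p.wMin) • (u : EuclideanSpace ℝ (Fin 3))) ⁻¹'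
      ((fun s => dist s p.posR ^ 2) ⁻¹' Set.Iic a)) =
      {u : Metric.sphere (0 : EuclideanSpace ℝ (Fin 3)) 1 | max (p.wER / (p.wER + p.wMin)) ta ≤ (u : EuclideanSpace ℝ (Fin 3)) 2} := by
    ext u
    rw [hcap]
    simp only [Set.mem_inter_iff, Set.mem_ofPred_eq, Set.mem_preimage, Set.mem_Iic, max_le_iff]
    refine and_congr Iff.rfl ?_
    have hu : (u : EuclideanSpace ℝ (Fin 3)) 0 ^ 2 + (u : EuclideanSpace ℝ (Fin 3)) 1 ^ 2 +
        (u : EuclideanSpace ℝ (Fin 3)) 2 ^ 2 = 1 := by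
      have h1 : ‖(u : EuclideanSpace ℝ (Fin 3))‖ ^ 2 = 1 := by
        rw [norm_eq_of_mem_sphere u, one_pow]
      rw [EuclideanSpace.norm_sq_eq, Fin.sum_univ_three] at h1
      simpa only [Real.norm_eq_abs, sq_abs] using h1
    rw [dist_posR_sq, hta, div_le_iff₀ (by positivity)]
    simp only [PiLp.smul_apply, smul_eq_mul]
    have h2 : ((p.wER + p.wMin) * (u : EuclideanSpace ℝ (Fin 3)) 0) ^ 2 +
        ((p.wER + p.wMin) * (u : EuclideanSpace ℝ (Fin 3)) 1) ^ 2 +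
        ((p.wER + p.wMin) * (u : EuclideanSpace ℝ (Fin 3)) 2 - p.wER) ^ 2 =
        (p.wER + p.wMin) ^ 2 + p.wER ^ 2 -
          (u : EuclideanSpace ℝ (Fin 3)) 2 * (2 * (p.wER + p.wMin) * p.wER) := by
      linear_combination (p.wER + p.wMin) ^ 2 * hu
    rw [h2]
    constructor <;> intro h <;> linarith
  rw [hint, hcap, toSphere_cap (lt_max_of_lt_left (by positivity)), toSphere_cap (by positivity),
    hp.wMax_sq]
  have e0 : 1 - p.wER / (p.wER + p.wMin) = p.wMin / (p.wER + p.wMin) := by field_simp; ring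
  have e1 : 1 - max (p.wER / (p.wER + p.wMin)) ta =
      (min (p.wMin ^ 2 + 2 * p.wER * p.wMin) a - p.wMin ^ 2) / (2 * (p.wER + p.wMin) * p.wER) := by
    have k1 : p.wER / (p.wER + p.wMin) = 1 - (p.wMin ^ 2 + 2 * p.wER * p.wMin - p.wMin ^ 2) /
        (2 * (p.wER + p.wMin) * p.wER) := by field_simp; ring
    have k2 : ta = 1 - (a - p.wMin ^ 2) / (2 * (p.wER + p.wMin) * p.wER) := by
      rw [hta]; field_simp; ring
    have hd : 0 < 2 * (p.wER + p.wMin) * p.wER := by positivity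
    rcases le_total (p.wMin ^ 2 + 2 * p.wER * p.wMin) a with h | h
    · rw [min_eq_left h, max_eq_left, k1]
      · ring
      · rw [k1, k2]
        gcongr
    · rw [min_eq_right h, max_eq_right, k2]
      · ring
      · rw [k1, k2]
        gcongr
  rw [e0, e1, ← ENNReal.ofReal_inv_of_pos (by positivity),
    ← ENNReal.ofReal_mul (by rw [add_sub_cancel_left]; positivity),
    ← ENNReal.ofReal_mul (by positivity)]
  congr 1
  field_simp
  ring

/-- By Pythagoras the squared distance is `h₀² + |x|²`, and the area of a disc is linear in its
squared radius. -/
theorem Valid.map_groundUserLaw (hp : p.Valid) :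
    p.groundUserLaw.map (fun d => dist p.posR d ^ 2) =
      uniformIcc (p.h0 ^ 2) (p.h0 ^ 2 + p.l ^ 2) := by
  symm
  refine Measure.ext_of_Iic _ _ fun a => ?_
  have hl := hp.l_pos
  have hmeas : Measurable fun x : EuclideanSpace ℝ (Fin 2) =>
      (!₂[x 0, x 1, p.wE] : EuclideanSpace ℝ (Fin 3)) := by
    refine (WithLp.measurable_toLp 2 _).comp (measurable_pi_lambda _ fun i => ?_)
    fin_cases i
    · simp; fun_prop
    · simp; fun_prop
    · simp
  have hmeas2 : Measurable fun s : EuclideanSpace ℝ (Fin 3) => dist p.posR s ^ 2 := by fun_prop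
  rw [uniformIcc_Iic, Measure.map_apply hmeas2 measurableSet_Iic, groundUserLaw,
    Measure.map_apply hmeas (hmeas2 measurableSet_Iic)]
  have hball : Metric.closedBall (0 : EuclideanSpace ℝ (Fin 2)) p.l =
      {x | x 0 ^ 2 + x 1 ^ 2 ≤ p.l ^ 2} := by
    ext x
    simp only [Set.mem_ofPred_eq, mem_closedBall_zero_iff]
    rw [← pow_le_pow_iff_left₀ (norm_nonneg x) hl.le two_ne_zero, EuclideanSpace.norm_sq_eq]
    simp [Fin.sum_univ_two]
  rw [cond_apply Metric.isClosed_closedBall.measurableSet]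
  have hint : Metric.closedBall (0 : EuclideanSpace ℝ (Fin 2)) p.l ∩
      ((fun x : EuclideanSpace ℝ (Fin 2) =>
        (!₂[x 0, x 1, p.wE] : EuclideanSpace ℝ (Fin 3))) ⁻¹'
      ((fun s => dist p.posR s ^ 2) ⁻¹' Set.Iic a)) =
      {x | x 0 ^ 2 + x 1 ^ 2 ≤ min (p.h0 ^ 2 + p.l ^ 2) a - p.h0 ^ 2} := by
    ext x
    rw [hball]
    simp only [Set.mem_inter_iff, Set.mem_ofPred_eq, Set.mem_preimage, Set.mem_Iic,
      le_sub_iff_add_le, le_min_iff]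
    rw [dist_comm, dist_posR_sq]
    have h2 : (!₂[x 0, x 1, p.wE] : EuclideanSpace ℝ (Fin 3)) 0 ^ 2 +
        (!₂[x 0, x 1, p.wE] : EuclideanSpace ℝ (Fin 3)) 1 ^ 2 +
        ((!₂[x 0, x 1, p.wE] : EuclideanSpace ℝ (Fin 3)) 2 - p.wER) ^ 2 =
        x 0 ^ 2 + x 1 ^ 2 + p.h0 ^ 2 := by
      simp [wER]
    rw [h2]
    constructor <;> rintro ⟨h, h'⟩ <;> exact ⟨by linarith, by linarith⟩
  rw [hint, hball, volume_euclidean_disc_le, volume_euclidean_disc_le,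
    ← ENNReal.ofReal_inv_of_pos (by positivity),
    ← ENNReal.ofReal_mul (by rw [add_sub_cancel_left]; positivity),
    ← ENNReal.ofReal_mul (by positivity)]
  congr 1
  field_simp
  ring

end Params

/-! ## The tail of the Gamma law -/

/-- `e^(-q) ∑_{n < m} q^n / n!`, the tail at `q` of the Gamma law with shape `m` and rate `1`. -/
def gammaTail (m : ℕ) (q : ℝ) : ℝ :=
  ∑ n ∈ Finset.range m, q ^ n / (n.factorial : ℝ) * Real.exp (-q)

theorem continuous_gammaTail (m : ℕ) : Continuous (gammaTail m) := by
  unfold gammaTail; fun_prop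

theorem gammaTail_nonneg (m : ℕ) {q : ℝ} (hq : 0 ≤ q) : 0 ≤ gammaTail m q := by
  unfold gammaTail; positivity

theorem gammaTail_le_one (m : ℕ) {q : ℝ} (hq : 0 ≤ q) : gammaTail m q ≤ 1 := by
  unfold gammaTail
  rw [← Finset.sum_mul, Real.exp_neg, ← div_eq_mul_inv, div_le_one (Real.exp_pos q)]
  exact Real.sum_le_exp_of_nonneg hq m

/-- The derivatives of consecutive summands telescope, leaving minus the Gamma density. -/
theorem hasDerivAt_gammaTail_succ (m : ℕ) (q : ℝ) :
    HasDerivAt (gammaTail (m + 1)) (-(q ^ m / (m.factorial : ℝ) * Real.exp (-q))) q := by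
  have hexp : HasDerivAt (fun q : ℝ => Real.exp (-q)) (-Real.exp (-q)) q := by
    simpa using (hasDerivAt_neg q).exp
  induction m with
  | zero =>
    have h1 : gammaTail (0 + 1) = fun q => Real.exp (-q) := by ext q; simp [gammaTail]
    rw [h1]; simpa using hexp
  | succ m ih =>
    have h1 : gammaTail (m + 1 + 1) = fun q => gammaTail (m + 1) q +
        q ^ (m + 1) / ((m + 1).factorial : ℝ) * Real.exp (-q) := by
      ext q; unfold gammaTail; rw [Finset.sum_range_succ _ (m + 1)]
    rw [h1]
    have h2 := ih.add (((hasDerivAt_pow (m + 1) q).div_const ((m + 1).factorial : ℝ)).mul hexp)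
    refine h2.congr_deriv ?_
    rw [Nat.factorial_succ]
    have : (m.factorial : ℝ) ≠ 0 := by positivity
    push_cast
    field_simp
    ring

theorem tendsto_gammaTail_atTop (m : ℕ) :
    Filter.Tendsto (gammaTail m) Filter.atTop (nhds 0) := by
  have h1 : gammaTail m = fun q => ∑ n ∈ Finset.range m,
      (1 / (n.factorial : ℝ)) * (q ^ n * Real.exp (-q)) := by
    ext q; unfold gammaTail
    exact Finset.sum_congr rfl fun n _ => by ring
  rw [h1, show (0 : ℝ) = ∑ n ∈ Finset.range m, (1 / (n.factorial : ℝ)) * 0 by simp]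
  exact tendsto_finsetSum _ fun n _ =>
    (Real.tendsto_pow_mul_exp_neg_atTop_nhds_zero n).const_mul _

/-- The negated tail is an antiderivative of the density and tends to 0 at infinity; an integer
shape makes it elementary. -/
theorem gammaMeasure_nat_Ioi {m : ℕ} (hm : 0 < m) {r y : ℝ} (hr : 0 < r) (hy : 0 ≤ y) :
    gammaMeasure m r (Set.Ioi y) = ENNReal.ofReal (gammaTail m (r * y)) := by
  obtain ⟨k, rfl⟩ : ∃ k, m = k + 1 := ⟨m - 1, by omega⟩
  have hder : ∀ x ∈ Set.Ici y, HasDerivAt (fun x => -gammaTail (k + 1) (r * x))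
      ((r * x) ^ k / (k.factorial : ℝ) * Real.exp (-(r * x)) * r) x := by
    intro x _
    have h1 : HasDerivAt (fun x : ℝ => r * x) r x := by
      simpa using (hasDerivAt_id x).const_mul r
    have h2 := ((hasDerivAt_gammaTail_succ k (r * x)).comp x h1).neg
    exact h2.congr_deriv (by ring)
  have hpos : ∀ x ∈ Set.Ioi y,
      0 ≤ (r * x) ^ k / (k.factorial : ℝ) * Real.exp (-(r * x)) * r := by
    intro x hx
    have : 0 ≤ x := hy.trans (le_of_lt hx)
    positivity
  have hlim : Filter.Tendsto (fun x => -gammaTail (k + 1) (r * x)) Filter.atTop (nhds 0) := by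
    have := (tendsto_gammaTail_atTop (k + 1)).comp (Filter.tendsto_id.const_mul_atTop hr)
    simpa using this.neg
  have hint := integral_Ioi_of_hasDerivAt_of_nonneg' hder hpos hlim
  have hintble := integrableOn_Ioi_deriv_of_nonneg' hder hpos hlim
  rw [gammaMeasure, withDensity_apply _ measurableSet_Ioi]
  rw [show gammaTail (k + 1) (r * y) = 0 - -gammaTail (k + 1) (r * y) by ring, ← hint,
    ofReal_integral_eq_lintegral_ofReal hintble
      ((ae_restrict_mem measurableSet_Ioi).mono fun x hx => hpos x hx)]
  refine setLIntegral_congr_fun measurableSet_Ioi fun x hx => ?_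
  have hx : y < x := hx
  have hx0 : 0 ≤ x := hy.trans hx.le
  simp only [gammaPDF, gammaPDFReal, if_pos hx0]
  congr 1
  push_cast
  rw [Real.Gamma_nat_eq_factorial, add_sub_cancel_right, Real.rpow_natCast, ← Nat.cast_succ,
    Real.rpow_natCast, mul_pow, Nat.succ_eq_add_one]
  ring

/-! ### Signs of the derived parameters and of the shadowed-Rician density -/

namespace Params

variable {p : Params}

theorem Valid.delta_nonneg (hp : p.Valid) : 0 ≤ p.delta := by
  have := hp.b_pos; have := hp.Om_nonneg
  unfold delta; positivity

theorem Valid.alpha_pos (hp : p.Valid) : 0 < p.alpha := by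
  have := hp.b_pos; have := hp.Om_nonneg
  have : (0 : ℝ) < p.mS := Nat.cast_pos.2 hp.mS_pos
  unfold alpha; positivity

theorem Valid.betaBar_pos (hp : p.Valid) : 0 < p.betaBar := by
  have hb := hp.b_pos; have hO := hp.Om_nonneg
  have hm : (0 : ℝ) < p.mS := Nat.cast_pos.2 hp.mS_pos
  have h : p.betaBar = p.mS / (2 * p.b * p.mS + p.Om) := by
    unfold betaBar beta delta; field_simp; ring
  rw [h]; positivity

theorem Valid.chiRE_pos (hp : p.Valid) : 0 < p.chiRE := by
  have h1 : 0 < 1 - p.rho := sub_pos.2 hp.rho_lt_one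
  have h2 := hp.rho_nonneg
  have h3 := hp.eps_nonneg
  refine mul_pos hp.chi_pos ?_
  rcases hp.harvests with h | h
  · positivity
  · positivity

theorem Valid.muE_pos (hp : p.Valid) : 0 < p.muE := by
  have h1 : 0 < 1 - p.eps := sub_pos.2 hp.eps_lt_one
  have h2 := hp.mu_pos; have h3 := hp.sigmaR2_pos; have h4 := hp.sigmaRB2_pos
  unfold muE; positivity

theorem Valid.B_pos (hp : p.Valid) {γ : ℝ} (hγ : 0 < γ) : 0 < p.B γ :=
  mul_pos (mul_pos hp.muE_pos hp.chiRE_pos) hγ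

theorem Valid.A_pos_iff (hp : p.Valid) {γ : ℝ} : 0 < p.A γ ↔ γ < p.muPrime := by
  have h1 : 0 < 1 - p.mu := sub_pos.2 hp.mu_lt_one
  rw [A, muPrime, lt_div_iff₀ h1, mul_pos_iff_of_pos_left (mul_pos hp.chiRE_pos hp.etaS_pos),
    sub_pos, mul_comm]

/-- The signed Pochhammer symbol `(-1)^j (1-m)_j` is `(m-1)(m-2)⋯(m-j)`, whose factors are
nonnegative for `j < m`. -/
theorem zeta_nonneg (hp : p.Valid) {k : ℕ} (hk : k < p.mS) : 0 ≤ p.zeta k := by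
  have key : ∀ j : ℕ, j < p.mS → 0 ≤ (-1 : ℝ) ^ j * (ascPochhammer ℝ j).eval (1 - (p.mS : ℝ)) := by
    intro j
    induction j with
    | zero => intro _; simp
    | succ j ih =>
      intro hj
      have h1 := ih (by omega)
      have h2 : (0 : ℝ) ≤ p.mS - 1 - j := by
        have : ((j + 1 : ℕ) : ℝ) + 1 ≤ p.mS := by exact_mod_cast hj
        push_cast at this; linarith
      rw [ascPochhammer_succ_eval]
      have h3 := mul_nonneg h1 h2
      calc (0 : ℝ) ≤ _ := h3
        _ = _ := by rw [pow_succ]; ring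
  have h1 := hp.delta_nonneg
  have h2 := key k hk
  unfold zeta
  positivity

/-- The shadowed-Rician density. -/
def shadowedRicianDensity (p : Params) (x : ℝ) : ℝ :=
  p.alpha * ∑ k ∈ Finset.range p.mS, p.zeta k * x ^ k * Real.exp (-(p.beta - p.delta) * x)

theorem continuous_shadowedRicianDensity (p : Params) : Continuous p.shadowedRicianDensity := by
  unfold shadowedRicianDensity; fun_prop

theorem Valid.shadowedRicianDensity_nonneg (hp : p.Valid) {x : ℝ} (hx : 0 ≤ x) :
    0 ≤ p.shadowedRicianDensity x := by
  refine mul_nonneg hp.alpha_pos.le (Finset.sum_nonneg fun k hk => ?_)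
  have := zeta_nonneg hp (Finset.mem_range.1 hk)
  positivity

/-! ## The event in the squared distances -/

/-- The event of `P1` for the squared distances `u = w_sr²`, `r = w_rd²` and the power gains
`x`, `y`. -/
def gainEvent (p : Params) (γ : ℝ) : Set ((ℝ × ℝ) × (ℝ × ℝ)) :=
  {z | p.B γ < p.A γ * (z.2.1 / z.1.1) ∧
    γ * p.sigmaD2 * z.1.2 ^ (p.nu / 2) < z.2.2 * (p.A γ * (z.2.1 / z.1.1) - p.B γ) ∧
    p.etaS * (z.2.1 / z.1.1) ≤ p.Pth}

theorem measurableSet_gainEvent (p : Params) (γ : ℝ) : MeasurableSet (p.gainEvent γ) := by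
  have h : p.gainEvent γ = {z | p.B γ < p.A γ * (z.2.1 / z.1.1)} ∩
      ({z | γ * p.sigmaD2 * z.1.2 ^ (p.nu / 2) < z.2.2 * (p.A γ * (z.2.1 / z.1.1) - p.B γ)} ∩
      {z | p.etaS * (z.2.1 / z.1.1) ≤ p.Pth}) := rfl
  rw [h]
  exact (measurableSet_lt (by fun_prop) (by fun_prop)).inter
    ((measurableSet_lt (by fun_prop) (by fun_prop)).inter
      (measurableSet_le (by fun_prop) (by fun_prop)))

/-- The denominator is positive because of `σ_d²`; after clearing it, the terms containing both
gains combine into `A` and the relay noise into `B`. -/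
theorem Valid.lt_snrLinear_iff (hp : p.Valid) {γ x w y v : ℝ} (hx : 0 ≤ x)
    (hy : 0 ≤ y) (hv : 0 ≤ v) :
    γ < p.snrLinear x w y v ↔
      γ * p.sigmaD2 < y * v ^ (-p.nu) * (p.A γ * (x * w ^ (-2 : ℤ)) - p.B γ) := by
  have h1 : 0 < 1 - p.mu := sub_pos.2 hp.mu_lt_one
  have h2 := hp.muE_pos; have h3 := hp.chiRE_pos; have h4 := hp.etaS_pos
  have h5 : 0 ≤ v ^ (-p.nu) := Real.rpow_nonneg hv _
  have h6 : 0 ≤ w ^ (-2 : ℤ) := Even.zpow_nonneg (by decide) w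
  have h7 := hp.sigmaD2_pos
  unfold snrLinear
  rw [lt_div_iff₀ (by positivity)]
  unfold A B
  constructor <;> intro h <;> nlinarith

theorem Valid.event_iff_mem_gainEvent (hp : p.Valid) {γ x w y v : ℝ} (hγ : 0 < γ) (hx : 0 ≤ x)
    (hy : 0 ≤ y) (hv : 0 < v) :
    (γ < p.snrLinear x w y v ∧ p.etaS * x * w ^ (-2 : ℤ) ≤ p.Pth) ↔
      ((w ^ 2, v ^ 2), (x, y)) ∈ p.gainEvent γ := by
  rw [hp.lt_snrLinear_iff hx hy hv.le]
  have h7 := hp.sigmaD2_pos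
  have hz : x * w ^ (-2 : ℤ) = x / w ^ 2 := by rw [zpow_neg, ← div_eq_mul_inv]; norm_cast
  have hvv : (v ^ 2) ^ (p.nu / 2) = v ^ p.nu := by
    rw [← Real.rpow_natCast, ← Real.rpow_mul hv.le]; congr 1; push_cast; ring
  have hvp : 0 < v ^ p.nu := Real.rpow_pos_of_pos hv _
  simp only [gainEvent, Set.mem_ofPred_eq]
  rw [mul_assoc p.etaS, hz, hvv, Real.rpow_neg hv.le]
  have he : γ * p.sigmaD2 < y * (v ^ p.nu)⁻¹ * (p.A γ * (x / w ^ 2) - p.B γ) ↔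
      γ * p.sigmaD2 * v ^ p.nu < y * (p.A γ * (x / w ^ 2) - p.B γ) := by
    rw [← lt_div_iff₀ hvp]
    rw [show y * (v ^ p.nu)⁻¹ * (p.A γ * (x / w ^ 2) - p.B γ) =
      y * (p.A γ * (x / w ^ 2) - p.B γ) / v ^ p.nu by ring]
  rw [he]
  constructor
  · rintro ⟨h1, h2⟩
    -- The first clause of `gainEvent` follows from the second when `y ≥ 0`; it is listed separately
    -- so that every section in `y` is empty or a half-line.
    refine ⟨?_, h1, h2⟩
    have h3 : 0 < γ * p.sigmaD2 * v ^ p.nu := by positivity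
    exact sub_pos.1 (pos_of_mul_pos_right (h3.trans h1) hy)
  · rintro ⟨-, h1, h2⟩
    exact ⟨h1, h2⟩

/-- The integrand for `P1`, with `τ = A |g_sr|² w_sr^{-2} - B`. -/
def coverageIntegrand (p : Params) (γ : ℝ) (z : ℝ × (ℝ × ℝ)) : ℝ :=
  z.1 / p.A γ * p.shadowedRicianDensity (z.1 * (z.2.2 + p.B γ) / p.A γ) *
    gammaTail p.mD (p.mD * p.sigmaD2 * γ * z.2.1 ^ (p.nu / 2) / z.2.2)

theorem measurable_coverageIntegrand (p : Params) (γ : ℝ) :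
    Measurable (p.coverageIntegrand γ) := by
  have h1 := p.continuous_shadowedRicianDensity.measurable
  have h2 := (continuous_gammaTail p.mD).measurable
  unfold coverageIntegrand
  refine ((by fun_prop : Measurable fun z : ℝ × (ℝ × ℝ) => z.1 / p.A γ).mul
    (h1.comp (by fun_prop))).mul (h2.comp (by fun_prop))

/-- For fixed distances, `x` ranges over an interval `I`, and for each such `x` the `y`-section is a
half-line whose mass is a Gamma tail. The substitution `x = u (τ + B)/A` carries `(0, P_{A,B}]` onto
`I`, with Jacobian `u/A`. -/
theorem Valid.measure_gainEvent_section (hp : p.Valid) {γ u r : ℝ} (hγ : 0 < γ)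
    (hA : 0 < p.A γ) (hu : 0 < u) (hr : 0 < r) :
    (p.shadowedRicianLaw.prod p.nakagamiPowerLaw) (Prod.mk (u, r) ⁻¹' p.gainEvent γ) =
      ∫⁻ τ in Set.Ioc 0 (p.PAB γ), ENNReal.ofReal (p.coverageIntegrand γ (u, (r, τ))) := by
  have hB := hp.B_pos hγ
  have hη := hp.etaS_pos
  have hσ := hp.sigmaD2_pos
  have hmD : (0 : ℝ) < p.mD := Nat.cast_pos.2 hp.mD_pos
  have : SFinite p.nakagamiPowerLaw := by
    unfold nakagamiPowerLaw gammaMeasure; infer_instance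
  have hsec := measurable_prodMk_left (x := (u, r)) (p.measurableSet_gainEvent γ)
  set I := Set.Ioc (u * p.B γ / p.A γ) (u * p.Pth / p.etaS) with hI
  set T : ℝ → ENNReal := fun x => ENNReal.ofReal (gammaTail p.mD
    (p.mD * p.sigmaD2 * γ * r ^ (p.nu / 2) / (p.A γ * (x / u) - p.B γ))) with hT
  have hslice : ∀ x, p.nakagamiPowerLaw (Prod.mk x ⁻¹' (Prod.mk (u, r) ⁻¹' p.gainEvent γ)) =
      I.indicator T x := by
    intro x
    have hxI : x ∈ I ↔ p.B γ < p.A γ * (x / u) ∧ p.etaS * (x / u) ≤ p.Pth := by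
      rw [hI, Set.mem_Ioc, div_lt_iff₀ hA, le_div_iff₀ hη, ← mul_div_assoc, ← mul_div_assoc,
        lt_div_iff₀ hu, div_le_iff₀ hu]
      constructor <;> rintro ⟨h1, h2⟩ <;> constructor <;> linarith
    by_cases hx : x ∈ I
    · rw [Set.indicator_of_mem hx]
      obtain ⟨h1, h2⟩ := hxI.1 hx
      have h3 : 0 < p.A γ * (x / u) - p.B γ := sub_pos.2 h1
      have h4 : Prod.mk x ⁻¹' (Prod.mk (u, r) ⁻¹' p.gainEvent γ) =
          Set.Ioi (γ * p.sigmaD2 * r ^ (p.nu / 2) / (p.A γ * (x / u) - p.B γ)) := by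
        ext y
        simp only [gainEvent, Set.mem_preimage, Set.mem_ofPred_eq, Set.mem_Ioi, div_lt_iff₀ h3]
        tauto
      rw [h4, nakagamiPowerLaw, gammaMeasure_nat_Ioi hp.mD_pos hmD (by positivity)]
      simp only [hT]
      congr 2
      ring
    · rw [Set.indicator_of_notMem hx]
      convert! measure_empty (μ := p.nakagamiPowerLaw)
      ext y
      simp only [gainEvent, Set.mem_preimage, Set.mem_ofPred_eq, Set.mem_empty_iff_false, iff_false]
      rintro ⟨h1, -, h2⟩
      exact hx (hxI.2 ⟨h1, h2⟩)
  have hTm : Measurable T :=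
    ENNReal.measurable_ofReal.comp ((continuous_gammaTail p.mD).measurable.comp (by fun_prop))
  have hdm : Measurable fun x => ENNReal.ofReal (p.shadowedRicianDensity x) :=
    ENNReal.measurable_ofReal.comp p.continuous_shadowedRicianDensity.measurable
  rw [Measure.prod_apply hsec]
  simp_rw [hslice]
  have hlaw : p.shadowedRicianLaw = (volume.restrict (Set.Ici 0)).withDensity
      fun x => ENNReal.ofReal (p.shadowedRicianDensity x) := rfl
  have hIsub : I ⊆ Set.Ici 0 := fun x hx => le_of_lt (lt_of_le_of_lt (by positivity) hx.1)
  rw [hlaw, lintegral_withDensity_eq_lintegral_mul _ hdm (hTm.indicator measurableSet_Ioc)]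
  have e1 : (fun x => ((fun x => ENNReal.ofReal (p.shadowedRicianDensity x)) * I.indicator T) x) =
      I.indicator fun x => ENNReal.ofReal (p.shadowedRicianDensity x) * T x := by
    ext x
    by_cases hx : x ∈ I <;> simp [hx]
  rw [e1, lintegral_indicator measurableSet_Ioc, Measure.restrict_restrict measurableSet_Ioc,
    Set.inter_eq_left.2 hIsub]
  have himg : (fun τ : ℝ => u * (τ + p.B γ) / p.A γ) '' Set.Ioc 0 (p.PAB γ) = I := by
    ext x
    constructor
    · rintro ⟨τ, ⟨h1, h2⟩, rfl⟩
      rw [hI, Set.mem_Ioc]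
      refine ⟨by simp only; gcongr; linarith, ?_⟩
      have h3 : τ + p.B γ ≤ p.Pth * p.A γ / p.etaS := by unfold PAB at h2; linarith
      calc u * (τ + p.B γ) / p.A γ ≤ u * (p.Pth * p.A γ / p.etaS) / p.A γ := by gcongr
        _ = _ := by field_simp
    · rintro ⟨h1, h2⟩
      rw [div_lt_iff₀ hA] at h1
      rw [le_div_iff₀ hη] at h2
      refine ⟨p.A γ * x / u - p.B γ, ⟨?_, ?_⟩, ?_⟩
      · rw [sub_pos, lt_div_iff₀ hu]; linarith
      · unfold PAB
        refine sub_le_sub_right ?_ _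
        rw [div_le_div_iff₀ hu hη]
        nlinarith
      · field_simp; ring
  rw [← himg, lintegral_image_eq_lintegral_abs_deriv_mul (f' := fun _ => u / p.A γ)
    measurableSet_Ioc (fun τ _ => by
      have h := (((hasDerivAt_id τ).add_const (p.B γ)).const_mul u).div_const (p.A γ)
      simpa using h.hasDerivWithinAt)
    (fun a _ b _ h => by
      have h' : u * (a + p.B γ) = u * (b + p.B γ) := (div_left_inj' hA.ne').1 h
      have := mul_left_cancel₀ hu.ne' h'
      linarith)]
  refine setLIntegral_congr_fun measurableSet_Ioc fun τ hτ => ?_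
  have hτ0 := hτ.1
  have e2 : p.A γ * (u * (τ + p.B γ) / p.A γ / u) - p.B γ = τ := by field_simp; ring
  have hd : 0 ≤ p.shadowedRicianDensity (u * (τ + p.B γ) / p.A γ) :=
    hp.shadowedRicianDensity_nonneg (by positivity)
  simp only [hT, e2, coverageIntegrand]
  rw [abs_of_pos (by positivity), ENNReal.ofReal_mul (by positivity),
    ENNReal.ofReal_mul (by positivity), mul_assoc (ENNReal.ofReal _)]

end Params

/-! ### The probability as an integral over a box -/

namespace Params

variable {p : Params}

/-- Lebesgue measure on the range of `(w_sr², (w_rd², τ))`. -/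
def boxMeasure (p : Params) (γ : ℝ) : Measure (ℝ × (ℝ × ℝ)) :=
  (volume.restrict (Set.Icc (p.wMin ^ 2) (p.wMax ^ 2))).prod
    ((volume.restrict (Set.Icc (p.h0 ^ 2) (p.h0 ^ 2 + p.l ^ 2))).prod
      (volume.restrict (Set.Ioc 0 (p.PAB γ))))

theorem ae_boxMeasure (p : Params) (γ : ℝ) :
    ∀ᵐ z ∂p.boxMeasure γ, z.1 ∈ Set.Icc (p.wMin ^ 2) (p.wMax ^ 2) ∧
      z.2.1 ∈ Set.Icc (p.h0 ^ 2) (p.h0 ^ 2 + p.l ^ 2) ∧ z.2.2 ∈ Set.Ioc 0 (p.PAB γ) := by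
  unfold boxMeasure
  rw [Measure.prod_restrict, Measure.prod_restrict]
  exact ae_restrict_mem (measurableSet_Icc.prod (measurableSet_Icc.prod measurableSet_Ioc))

theorem Valid.coverageIntegrand_nonneg (hp : p.Valid) {γ : ℝ} (hγ : 0 < γ) (hA : 0 < p.A γ)
    {z : ℝ × (ℝ × ℝ)} (h1 : 0 ≤ z.1) (h2 : 0 ≤ z.2.1) (h3 : 0 ≤ z.2.2) :
    0 ≤ p.coverageIntegrand γ z := by
  have hB := hp.B_pos hγ
  have hσ := hp.sigmaD2_pos
  exact mul_nonneg (mul_nonneg (by positivity)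
    (hp.shadowedRicianDensity_nonneg (by positivity))) (gammaTail_nonneg _ (by positivity))

/-- Independence makes the joint law of squared distances and gains a product, so Tonelli reduces
the probability to the sections with fixed distances. The constants are the two uniform densities.
-/
theorem Valid.P1_eq_integral (hp : p.Valid) {Ω : Type*} [MeasurableSpace Ω] {P : Measure Ω}
    [IsProbabilityMeasure P] {gsr grd : Ω → ℂ} {S D : Ω → EuclideanSpace ℝ (Fin 3)}
    (hgsr : HasLaw (fun ω => ‖gsr ω‖ ^ 2) p.shadowedRicianLaw P)
    (hgrd : HasLaw (fun ω => ‖grd ω‖ ^ 2) p.nakagamiPowerLaw P)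
    (hS : HasLaw S p.satelliteLaw P)
    (hD : HasLaw D p.groundUserLaw P)
    (hindep : iIndepFun
      (![fun ω => ‖gsr ω‖ ^ 2, fun ω => ‖grd ω‖ ^ 2, fun ω => dist (S ω) p.posR,
        fun ω => dist p.posR (D ω)] : Fin 4 → Ω → ℝ) P)
    {γ : ℝ} (hγ : 0 < γ) (hA : 0 < p.A γ) :
    p.P1 P gsr grd S D γ = 1 / (p.wMax ^ 2 - p.wMin ^ 2) * (1 / p.l ^ 2) *
      ∫ z, p.coverageIntegrand γ z ∂p.boxMeasure γ := by
  have hh := hp.h0_pos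
  have hw := hp.wMin_pos
  have hl := hp.l_pos
  have hWm : AEMeasurable (fun ω => dist (S ω) p.posR) P :=
    (by fun_prop : Measurable fun s : EuclideanSpace ℝ (Fin 3) => dist s p.posR).comp_aemeasurable
      hS.aemeasurable
  have hVm : AEMeasurable (fun ω => dist p.posR (D ω)) P :=
    (by fun_prop : Measurable fun s : EuclideanSpace ℝ (Fin 3) => dist p.posR s).comp_aemeasurable
      hD.aemeasurable
  have hXm := hgsr.aemeasurable
  have hYm := hgrd.aemeasurable
  have hall : ∀ i : Fin 4, AEMeasurable ((![fun ω => ‖gsr ω‖ ^ 2, fun ω => ‖grd ω‖ ^ 2,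
      fun ω => dist (S ω) p.posR, fun ω => dist p.posR (D ω)] : Fin 4 → Ω → ℝ) i) P := by
    intro i
    fin_cases i
    · exact hXm
    · exact hYm
    · exact hWm
    · exact hVm
  have hsq : Measurable fun x : ℝ => x ^ 2 := by fun_prop
  have hW2 : P.map (fun ω => dist (S ω) p.posR ^ 2) = uniformIcc (p.wMin ^ 2) (p.wMax ^ 2) := by
    rw [← hp.map_satelliteLaw, ← hS.map_eq, AEMeasurable.map_map_of_aemeasurable
      (by fun_prop) hS.aemeasurable]
    rfl
  have hV2 : P.map (fun ω => dist p.posR (D ω) ^ 2) =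
      uniformIcc (p.h0 ^ 2) (p.h0 ^ 2 + p.l ^ 2) := by
    rw [← hp.map_groundUserLaw, ← hD.map_eq, AEMeasurable.map_map_of_aemeasurable
      (by fun_prop) hD.aemeasurable]
    rfl
  have i1 : IndepFun (fun ω => ‖gsr ω‖ ^ 2) (fun ω => ‖grd ω‖ ^ 2) P :=
    hindep.indepFun (i := 0) (j := 1) (by decide)
  have i2 : IndepFun (fun ω => dist (S ω) p.posR ^ 2) (fun ω => dist p.posR (D ω) ^ 2) P :=
    (hindep.indepFun (i := 2) (j := 3) (by decide)).comp hsq hsq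
  have i3 : IndepFun (fun ω => (dist (S ω) p.posR ^ 2, dist p.posR (D ω) ^ 2))
      (fun ω => (‖gsr ω‖ ^ 2, ‖grd ω‖ ^ 2)) P :=
    (hindep.indepFun_prodMk_prodMk₀ hall 2 3 0 1 (by decide) (by decide) (by decide)
      (by decide)).comp (φ := Prod.map (fun x : ℝ => x ^ 2) (fun x : ℝ => x ^ 2)) (ψ := id)
      (hsq.prodMap hsq) measurable_id
  have hW2m : AEMeasurable (fun ω => dist (S ω) p.posR ^ 2) P := hsq.comp_aemeasurable hWm
  have hV2m : AEMeasurable (fun ω => dist p.posR (D ω) ^ 2) P := hsq.comp_aemeasurable hVm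
  have hlaw : P.map (fun ω => ((dist (S ω) p.posR ^ 2, dist p.posR (D ω) ^ 2),
      (‖gsr ω‖ ^ 2, ‖grd ω‖ ^ 2))) =
      ((uniformIcc (p.wMin ^ 2) (p.wMax ^ 2)).prod
        (uniformIcc (p.h0 ^ 2) (p.h0 ^ 2 + p.l ^ 2))).prod
        (p.shadowedRicianLaw.prod p.nakagamiPowerLaw) := by
    rw [(indepFun_iff_map_prod_eq_prod_map_map (hW2m.prodMk hV2m) (hXm.prodMk hYm)).1 i3,
      (indepFun_iff_map_prod_eq_prod_map_map hW2m hV2m).1 i2,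
      (indepFun_iff_map_prod_eq_prod_map_map hXm hYm).1 i1, hgsr.map_eq, hgrd.map_eq]
    exact congrArg₂ _ (congrArg₂ _ hW2 hV2) rfl
  -- Multiplying by `w_rd^ν` needs `w_rd > 0`, which the law of `w_rd²`, supported above `h₀² > 0`,
  -- gives almost surely.
  have hVpos : ∀ᵐ ω ∂P, 0 < dist p.posR (D ω) := by
    have h1 : P.map (fun ω => dist p.posR (D ω) ^ 2) (Set.Iic 0) = 0 := by
      rw [hV2, uniformIcc_Iic, min_eq_right (by positivity),
        ENNReal.ofReal_of_nonpos (p := 0 - p.h0 ^ 2) (by nlinarith), mul_zero]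
    rw [Measure.map_apply_of_aemeasurable hV2m measurableSet_Iic] at h1
    refine measure_mono_null (fun ω hω => ?_) h1
    have h2 : ¬ 0 < dist p.posR (D ω) := hω
    have h3 : dist p.posR (D ω) = 0 := le_antisymm (not_lt.1 h2) dist_nonneg
    simp [h3]
  have hev : P {ω | γ < p.snrLinear (‖gsr ω‖ ^ 2) (dist (S ω) p.posR) (‖grd ω‖ ^ 2)
        (dist p.posR (D ω)) ∧
      p.etaS * ‖gsr ω‖ ^ 2 * dist (S ω) p.posR ^ (-2 : ℤ) ≤ p.Pth} =
      (((uniformIcc (p.wMin ^ 2) (p.wMax ^ 2)).prod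
        (uniformIcc (p.h0 ^ 2) (p.h0 ^ 2 + p.l ^ 2))).prod
        (p.shadowedRicianLaw.prod p.nakagamiPowerLaw)) (p.gainEvent γ) := by
    rw [← hlaw, Measure.map_apply_of_aemeasurable ((hW2m.prodMk hV2m).prodMk (hXm.prodMk hYm))
      (p.measurableSet_gainEvent γ)]
    refine measure_congr ?_
    filter_upwards [hVpos] with ω hω
    exact propext (hp.event_iff_mem_gainEvent hγ (sq_nonneg _) (sq_nonneg _) hω)
  have : SFinite p.shadowedRicianLaw := by unfold shadowedRicianLaw; infer_instance
  have : SFinite p.nakagamiPowerLaw := by unfold nakagamiPowerLaw gammaMeasure; infer_instance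
  have hGm : Measurable fun z => ENNReal.ofReal (p.coverageIntegrand γ z) :=
    ENNReal.measurable_ofReal.comp (p.measurable_coverageIntegrand γ)
  have hprod : (uniformIcc (p.wMin ^ 2) (p.wMax ^ 2)).prod
        (uniformIcc (p.h0 ^ 2) (p.h0 ^ 2 + p.l ^ 2)) =
      ENNReal.ofReal (1 / (p.wMax ^ 2 - p.wMin ^ 2)) • ENNReal.ofReal (1 / p.l ^ 2) •
        (volume.restrict (Set.Icc (p.wMin ^ 2) (p.wMax ^ 2))).prod
        (volume.restrict (Set.Icc (p.h0 ^ 2) (p.h0 ^ 2 + p.l ^ 2))) := by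
    unfold uniformIcc
    rw [Measure.prod_smul_left, Measure.prod_smul_right, add_sub_cancel_left]
  have hae : ∀ᵐ z ∂((volume.restrict (Set.Icc (p.wMin ^ 2) (p.wMax ^ 2))).prod
        (volume.restrict (Set.Icc (p.h0 ^ 2) (p.h0 ^ 2 + p.l ^ 2)))), 0 < z.1 ∧ 0 < z.2 := by
    rw [Measure.prod_restrict]
    filter_upwards [ae_restrict_mem (measurableSet_Icc.prod measurableSet_Icc)] with z hz
    exact ⟨lt_of_lt_of_le (by positivity) hz.1.1, lt_of_lt_of_le (by positivity) hz.2.1⟩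
  have hmain : (((uniformIcc (p.wMin ^ 2) (p.wMax ^ 2)).prod
        (uniformIcc (p.h0 ^ 2) (p.h0 ^ 2 + p.l ^ 2))).prod
        (p.shadowedRicianLaw.prod p.nakagamiPowerLaw)) (p.gainEvent γ) =
      ENNReal.ofReal (1 / (p.wMax ^ 2 - p.wMin ^ 2)) * (ENNReal.ofReal (1 / p.l ^ 2) *
        ∫⁻ z, ENNReal.ofReal (p.coverageIntegrand γ z) ∂p.boxMeasure γ) := by
    rw [Measure.prod_apply (p.measurableSet_gainEvent γ), hprod, lintegral_smul_measure,
      lintegral_smul_measure, smul_eq_mul, smul_eq_mul]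
    congr 2
    have h1 := lintegral_congr_ae (hae.mono fun z hz =>
      hp.measure_gainEvent_section (r := z.2) hγ hA hz.1 hz.2)
    refine h1.trans ?_
    have hm1 : Measurable fun z : ℝ × ℝ => ∫⁻ τ in Set.Ioc 0 (p.PAB γ),
        ENNReal.ofReal (p.coverageIntegrand γ (z.1, (z.2, τ))) :=
      Measurable.lintegral_prod_right' (f := fun y : (ℝ × ℝ) × ℝ =>
        ENNReal.ofReal (p.coverageIntegrand γ (y.1.1, (y.1.2, y.2))))
        (hGm.comp (by fun_prop))
    rw [lintegral_prod _ hm1.aemeasurable, boxMeasure, lintegral_prod _ hGm.aemeasurable]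
    congr 1 with u
    exact (lintegral_prod _ (hGm.comp measurable_prodMk_left).aemeasurable).symm
  have hint : ∫ z, p.coverageIntegrand γ z ∂p.boxMeasure γ =
      (∫⁻ z, ENNReal.ofReal (p.coverageIntegrand γ z) ∂p.boxMeasure γ).toReal := by
    refine integral_eq_lintegral_of_nonneg_ae ?_
      (p.measurable_coverageIntegrand γ).aestronglyMeasurable
    filter_upwards [p.ae_boxMeasure γ] with z hz
    exact hp.coverageIntegrand_nonneg hγ hA (le_trans (by positivity) hz.1.1)
      (le_trans (by positivity) hz.2.1.1) hz.2.2.1.le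
  have hpos : 0 ≤ p.wMax ^ 2 - p.wMin ^ 2 := by
    rw [hp.wMax_sq, add_sub_cancel_left]
    have := hp.wER_pos
    positivity
  unfold P1
  rw [measureReal_def, hev, hmain, ENNReal.toReal_mul, ENNReal.toReal_mul,
    ENNReal.toReal_ofReal (by positivity), ENNReal.toReal_ofReal (by positivity), hint]
  ring

end Params

/-! ### The separated integrals: incomplete Gamma differences and Meijer terms -/

theorem deltaGamma_mul {s b x y : ℝ} (hs : 0 < s) (hb : 0 < b) (hx : 0 ≤ x) (hxy : x ≤ y) :
    deltaGamma s (b * x) (b * y) =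
      b ^ s * ∫ u in Set.Icc x y, u ^ (s - 1) * Real.exp (-(b * u)) := by
  have hint : IntegrableOn (fun t : ℝ => t ^ (s - 1) * Real.exp (-t)) (Set.Ioi 0) := by
    simpa using integrableOn_rpow_mul_exp_neg_mul_Ioi hs one_pos
  have hbxy : b * x ≤ b * y := by gcongr
  have h0 : 0 ≤ b * x := by positivity
  have h1 : deltaGamma s (b * x) (b * y) =
      ∫ t in Set.Ioc (b * x) (b * y), t ^ (s - 1) * Real.exp (-t) := by
    unfold deltaGamma upperGamma
    rw [sub_eq_iff_eq_add, ← Set.Ioc_union_Ioi_eq_Ioi hbxy,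
      setIntegral_union (Set.Ioc_disjoint_Ioi le_rfl) measurableSet_Ioi]
    · exact hint.mono_set fun t ht => lt_of_le_of_lt h0 ht.1
    · exact hint.mono_set fun t ht => lt_of_le_of_lt (h0.trans hbxy) ht
  rw [h1, ← Set.image_mul_left_Ioc hb, integral_image_eq_integral_abs_deriv_smul
    (f' := fun _ => b) measurableSet_Ioc
    (fun t _ => by simpa using ((hasDerivAt_id t).const_mul b).hasDerivWithinAt)
    (fun t _ t' _ h => mul_left_cancel₀ hb.ne' h), integral_Icc_eq_integral_Ioc,
    ← integral_const_mul]
  refine setIntegral_congr_fun measurableSet_Ioc fun t ht => ?_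
  have ht0 : 0 < t := lt_of_le_of_lt hx ht.1
  simp only [smul_eq_mul, abs_of_pos hb]
  rw [Real.mul_rpow hb.le ht0.le, Real.rpow_sub_one hb.ne']
  field_simp

theorem deltaGamma_nat_mul {j : ℕ} {b x y : ℝ} (hb : 0 < b) (hx : 0 ≤ x) (hxy : x ≤ y) :
    deltaGamma ((j : ℝ) + 1) (b * x) (b * y) =
      b ^ (j + 1) * ∫ u in Set.Icc x y, u ^ j * Real.exp (-(b * u)) := by
  rw [deltaGamma_mul (by positivity) hb hx hxy, add_sub_cancel_right]
  simp_rw [Real.rpow_natCast]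
  norm_cast

theorem pow_mul_exp_neg_le {n : ℕ} {q : ℝ} (hq : 0 ≤ q) :
    q ^ n / (n.factorial : ℝ) * Real.exp (-q) ≤ 1 := by
  rw [Real.exp_neg, ← div_eq_mul_inv, div_le_one (Real.exp_pos q)]
  exact Real.pow_div_factorial_le_exp q hq n

/-- The power `τ^(j-n)` may be singular at 0, but `q^n/n! · e^(-q) ≤ 1` for `q = c r^(ν/2)/τ` bounds
the whole integrand by `P^j`. -/
theorem integrable_pow_mul_pow_div_mul_exp_neg {n j : ℕ} {c ν y P : ℝ} (hc : 0 ≤ c) :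
    Integrable (fun z : ℝ × ℝ => z.2 ^ j *
      ((c * z.1 ^ (ν / 2) / z.2) ^ n / (n.factorial : ℝ) * Real.exp (-(c * z.1 ^ (ν / 2) / z.2))))
      ((volume.restrict (Set.Ioo 0 y)).prod (volume.restrict (Set.Ioc 0 P))) := by
  refine Integrable.of_bound (C := P ^ j) (Measurable.aestronglyMeasurable (by fun_prop)) ?_
  rw [Measure.prod_restrict]
  filter_upwards [ae_restrict_mem (measurableSet_Ioo.prod measurableSet_Ioc)] with z hz
  have hr := hz.1.1
  have hτ := hz.2.1
  have hτP := hz.2.2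
  have hP := hτ.le.trans hτP
  rw [norm_mul, norm_pow, Real.norm_of_nonneg hτ.le, Real.norm_of_nonneg (by positivity)]
  calc _ ≤ P ^ j * 1 := by
        gcongr
        exact pow_mul_exp_neg_le (by positivity)
    _ = _ := mul_one _

/-- The difference of two Meijer terms as an integral over `r ∈ [h², y]`, `τ ∈ (0, P]`. -/
theorem rpow_mul_expRatioIntegral_sub {n j : ℕ} {c P ν h v : ℝ} (hc : 0 < c) (hP : 0 < P)
    (hν : 0 < ν) (hh : 0 < h) (hhv : h ≤ v) :
    P ^ (1 + (j : ℤ) - n) * c ^ n / (n.factorial : ℝ) *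
      (v ^ (ν * n + 2) * expRatioIntegral (n + 2 / ν) (1 + (j : ℝ) - n) (c * v ^ ν / P) -
        h ^ (ν * n + 2) * expRatioIntegral (n + 2 / ν) (1 + (j : ℝ) - n) (c * h ^ ν / P)) =
    ν / 2 * ∫ z, z.2 ^ j *
      ((c * z.1 ^ (ν / 2) / z.2) ^ n / (n.factorial : ℝ) * Real.exp (-(c * z.1 ^ (ν / 2) / z.2)))
      ∂((volume.restrict (Set.Icc (h ^ 2) (v ^ 2))).prod (volume.restrict (Set.Ioc 0 P))) := by
  have hν2 : 0 < 2 / ν := by positivity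
  have hn0 : (0 : ℝ) ≤ n := Nat.cast_nonneg n
  have hj0 : (0 : ℝ) ≤ j := Nat.cast_nonneg j
  have hv : 0 < v := hh.trans_le hhv
  set F : ℝ × ℝ → ℝ := fun z => z.2 ^ j *
      ((c * z.1 ^ (ν / 2) / z.2) ^ n / (n.factorial : ℝ) *
        Real.exp (-(c * z.1 ^ (ν / 2) / z.2))) with hF
  have key : ∀ w : ℝ, 0 < w → P ^ (1 + (j : ℤ) - n) * c ^ n / (n.factorial : ℝ) *
      (w ^ (ν * n + 2) * expRatioIntegral (n + 2 / ν) (1 + (j : ℝ) - n) (c * w ^ ν / P)) =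
      ν / 2 * ∫ r in Set.Ioo 0 (w ^ 2), ∫ τ in Set.Ioc 0 P, F (r, τ) := by
    intro w hw
    -- The choice `σ = n + 1/ν` lies in the strip for every `n` and `j`: it is below `a = n + 2/ν`,
    -- and `s + σ = 1 + j + 1/ν > 0`.
    have h1 := rpow_mul_expRatioIntegral (a := n + 2 / ν) (s := 1 + (j : ℝ) - n)
      (σ := n + 2 / ν / 2) (by positivity) (by linarith) (by linarith) hc hP hν hw
    rw [show ν * (n + 2 / ν) = ν * n + 2 by field_simp] at h1
    have hz : P ^ (1 + (j : ℤ) - n) = P ^ (1 + (j : ℝ) - n) := by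
      rw [← Real.rpow_intCast]; push_cast; rfl
    calc _ = c ^ n / (n.factorial : ℝ) * (P ^ (1 + (j : ℝ) - n) * w ^ (ν * n + 2) *
          expRatioIntegral (n + 2 / ν) (1 + (j : ℝ) - n) (c * w ^ ν / P)) := by rw [hz]; ring
      _ = _ := by
        rw [h1, mul_left_comm, ← integral_const_mul]
        congr 1
        refine setIntegral_congr_fun measurableSet_Ioo fun r hr => ?_
        have hr0 := hr.1
        rw [integral_Ioc_eq_integral_Ioo, ← mul_assoc, ← integral_const_mul]
        refine setIntegral_congr_fun measurableSet_Ioo fun τ hτ => ?_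
        have hτ0 := hτ.1
        simp only [hF]
        have e1 : τ ^ (1 + (j : ℝ) - n - 1) = τ ^ j / τ ^ n := by
          rw [show 1 + (j : ℝ) - n - 1 = (j : ℝ) - n by ring, Real.rpow_sub hτ0,
            Real.rpow_natCast, Real.rpow_natCast]
        have e2 : r ^ ((ν * n + 2) / 2 - 1) = (r ^ (ν / 2)) ^ n := by
          rw [← Real.rpow_natCast, ← Real.rpow_mul hr0.le]; congr 1; ring
        rw [e1, e2, div_pow, mul_pow]
        ring
  have hFi : ∀ y : ℝ, Integrable F
      ((volume.restrict (Set.Ioo 0 y)).prod (volume.restrict (Set.Ioc 0 P))) :=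
    fun y => integrable_pow_mul_pow_div_mul_exp_neg hc.le
  -- Half-open intervals glue exactly: `(0, v²)` is the disjoint union of `(0, h²)` and `[h², v²)`.
  have hsub : Set.Icc (h ^ 2) (v ^ 2) =ᵐ[volume] Set.Ico (h ^ 2) (v ^ 2) := Ico_ae_eq_Icc.symm
  have hi := (hFi (v ^ 2)).integral_prod_left
  have hh2 : h ^ 2 ≤ v ^ 2 := by gcongr
  have hu : Set.Ioo 0 (h ^ 2) ∪ Set.Ico (h ^ 2) (v ^ 2) = Set.Ioo 0 (v ^ 2) :=
    Set.Ioo_union_Ico_eq_Ioo (by positivity) hh2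
  have hIco : Set.Ico (h ^ 2) (v ^ 2) ⊆ Set.Ioo 0 (v ^ 2) := hu ▸ Set.subset_union_right
  have hIoo : Set.Ioo 0 (h ^ 2) ⊆ Set.Ioo 0 (v ^ 2) := hu ▸ Set.subset_union_left
  rw [mul_sub, key v hv, key h hh, ← mul_sub]
  congr 1
  rw [Measure.restrict_congr_set hsub, integral_prod, ← hu, setIntegral_union _ measurableSet_Ico]
  · ring
  · exact IntegrableOn.mono_set hi hIoo
  · exact IntegrableOn.mono_set hi hIco
  · exact Set.disjoint_left.2 fun x hx hx' => (hx.2.trans_le hx'.1).false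
  · have := hFi (v ^ 2)
    refine this.mono_measure ?_
    exact Measure.prod_mono (Measure.restrict_mono hIco le_rfl) le_rfl

/-! ### Series expansion of the box integral and its termwise identification -/

namespace Params

variable {p : Params}

theorem Valid.meijerFactor_eq (hp : p.Valid) {γ v : ℝ} (hγ : 0 < γ) (hP : 0 < p.PAB γ)
    (hv : 0 < v) (k₁ k₂ n : ℕ) :
    p.meijerFactor γ v k₁ k₂ n = (expRatioIntegral (n + 2 / p.nu)
      (1 + ((k₁ + k₂ : ℕ) : ℝ) - n) (p.mD * p.sigmaD2 * γ * v ^ p.nu / p.PAB γ) : ℂ) := by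
  have hmD : (0 : ℝ) < p.mD := Nat.cast_pos.2 hp.mD_pos
  have hσ := hp.sigmaD2_pos
  have hsep := p.meijer_separates hp k₁ k₂ n
  have hvp : 0 < v ^ p.nu := Real.rpow_pos_of_pos hv _
  have e1 : p.meijerTop k₁ k₂ n = ![1 - ((n + 2 / p.nu : ℝ) : ℂ),
      ((1 + ((k₁ + k₂ : ℕ) : ℝ) - n : ℝ) : ℂ) + 1] := by
    unfold meijerTop varsigma1
    push_cast
    congr 1 <;> ring_nf
  have e2 : p.meijerBot k₁ k₂ n = ![((1 + ((k₁ + k₂ : ℕ) : ℝ) - n : ℝ) : ℂ), 0,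
      -((n + 2 / p.nu : ℝ) : ℂ)] := by
    unfold meijerBot varsigma1
    push_cast
    ring_nf
  unfold meijerFactor
  rw [e1, e2] at hsep ⊢
  exact meijerG_eq_expRatioIntegral (by positivity) hsep

/-- Division by zero makes the argument 0. The lower parameter 0 forces the contour into `Re s < 0`,
where `0 ^ s` is 0 by convention, so the integrand vanishes identically. This is how the boundary
case receives its limit value. -/
theorem meijerFactor_of_PAB_eq_zero (hp : p.Valid) {γ : ℝ} (hP : p.PAB γ = 0) (v : ℝ)
    (k₁ k₂ n : ℕ) : p.meijerFactor γ v k₁ k₂ n = 0 := by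
  have hsep := p.meijer_separates hp k₁ k₂ n
  unfold meijerFactor meijerG
  rw [dif_pos hsep, hP, div_zero]
  have hc : hsep.choose < 0 := by
    have := hsep.choose_spec.1 1 (by decide)
    simpa [meijerBot] using this
  have hz : ∀ y : ℝ, (((0 : ℝ) : ℂ)) ^ ((hsep.choose : ℂ) + y * Complex.I) = 0 := by
    intro y
    rw [Complex.ofReal_zero, Complex.zero_cpow]
    intro h
    have := congrArg Complex.re h
    simp at this
    linarith
  simp only [meijerIntegrand, hz, mul_zero, integral_zero]

/-- The `k₂`-th term of the exponential series of the coverage integrand. -/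
def seriesIntegrand (p : Params) (γ : ℝ) (k k₁ k₂ : ℕ) (z : ℝ × (ℝ × ℝ)) : ℝ :=
  (z.1 ^ (k + k₂ + 1) * Real.exp (-(p.betaBar * p.B γ / p.A γ * z.1))) *
    ((-(p.betaBar / p.A γ)) ^ k₂ / (k₂.factorial : ℝ) * (z.2.2 ^ (k₁ + k₂) *
      gammaTail p.mD (p.mD * p.sigmaD2 * γ * z.2.1 ^ (p.nu / 2) / z.2.2)))

/-- The sum over `k₂` of `seriesIntegrand`. -/
def seriesSum (p : Params) (γ : ℝ) (k k₁ : ℕ) (z : ℝ × (ℝ × ℝ)) : ℝ :=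
  z.1 ^ (k + 1) * Real.exp (-(p.betaBar * p.B γ / p.A γ * z.1)) *
    Real.exp (-(p.betaBar / p.A γ * z.1 * z.2.2)) * z.2.2 ^ k₁ *
      gammaTail p.mD (p.mD * p.sigmaD2 * γ * z.2.1 ^ (p.nu / 2) / z.2.2)

theorem hasSum_seriesIntegrand (p : Params) (γ : ℝ) (k k₁ : ℕ) (z : ℝ × (ℝ × ℝ)) :
    HasSum (fun k₂ => p.seriesIntegrand γ k k₁ k₂ z) (p.seriesSum γ k k₁ z) := by
  have h1 := NormedSpace.expSeries_div_hasSum_exp (-(p.betaBar / p.A γ * z.1 * z.2.2))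
  rw [← Real.exp_eq_exp_ℝ] at h1
  have h2 := h1.mul_left (z.1 ^ (k + 1) * Real.exp (-(p.betaBar * p.B γ / p.A γ * z.1)) *
    z.2.2 ^ k₁ * gammaTail p.mD (p.mD * p.sigmaD2 * γ * z.2.1 ^ (p.nu / 2) / z.2.2))
  have e1 : p.seriesSum γ k k₁ z = z.1 ^ (k + 1) *
      Real.exp (-(p.betaBar * p.B γ / p.A γ * z.1)) * z.2.2 ^ k₁ *
      gammaTail p.mD (p.mD * p.sigmaD2 * γ * z.2.1 ^ (p.nu / 2) / z.2.2) *
      Real.exp (-(p.betaBar / p.A γ * z.1 * z.2.2)) := by unfold seriesSum; ring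
  rw [e1]
  refine Eq.mpr (congrArg (fun f : ℕ → ℝ => HasSum f _) (funext fun k₂ => ?_)) h2
  unfold seriesIntegrand
  rw [show -(p.betaBar / p.A γ * z.1 * z.2.2) = -(p.betaBar / p.A γ) * z.1 * z.2.2 by ring]
  ring

theorem measurable_gammaTail_ratio (p : Params) (γ : ℝ) : Measurable fun z : ℝ × ℝ =>
    gammaTail p.mD (p.mD * p.sigmaD2 * γ * z.1 ^ (p.nu / 2) / z.2) :=
  (continuous_gammaTail p.mD).measurable.comp (by fun_prop)

theorem measurable_seriesIntegrand (p : Params) (γ : ℝ) (k k₁ k₂ : ℕ) :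
    Measurable (p.seriesIntegrand γ k k₁ k₂) := by
  have := (p.measurable_gammaTail_ratio γ).comp
    (measurable_snd : Measurable fun z : ℝ × (ℝ × ℝ) => z.2)
  unfold seriesIntegrand
  exact (by fun_prop : Measurable fun z : ℝ × (ℝ × ℝ) => _).mul
    (((by fun_prop : Measurable fun z : ℝ × (ℝ × ℝ) => z.2.2 ^ (k₁ + k₂)).mul this).const_mul _)

theorem measurable_seriesSum (p : Params) (γ : ℝ) (k k₁ : ℕ) :
    Measurable (p.seriesSum γ k k₁) := by
  have := (p.measurable_gammaTail_ratio γ).comp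
    (measurable_snd : Measurable fun z : ℝ × (ℝ × ℝ) => z.2)
  unfold seriesSum
  exact (by fun_prop : Measurable fun z : ℝ × (ℝ × ℝ) => _).mul this

instance (p : Params) (γ : ℝ) : IsFiniteMeasure (p.boxMeasure γ) := by
  unfold boxMeasure; infer_instance

/-- On the box the Gamma tail and the exponential are at most 1 and the powers are bounded, leaving
the terms of a convergent exponential series: a constant dominating function. -/
theorem Valid.norm_seriesIntegrand_le (hp : p.Valid) {γ : ℝ} (hγ : 0 < γ) (hA : 0 < p.A γ)
    (k k₁ k₂ : ℕ) : ∀ᵐ z ∂p.boxMeasure γ, ‖p.seriesIntegrand γ k k₁ k₂ z‖ ≤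
      (p.wMax ^ 2) ^ (k + 1) * p.PAB γ ^ k₁ *
        ((p.wMax ^ 2 * (p.betaBar / p.A γ) * p.PAB γ) ^ k₂ / (k₂.factorial : ℝ)) := by
  filter_upwards [p.ae_boxMeasure γ] with z hz
  obtain ⟨⟨hu1, hu2⟩, ⟨hr1, -⟩, ⟨hτ1, hτ2⟩⟩ := hz
  have hP := hτ1.le.trans hτ2
  have hu : 0 ≤ z.1 := le_trans (by positivity) hu1
  have hr : 0 ≤ z.2.1 := le_trans (by positivity) hr1
  have hb := hp.betaBar_pos
  have hB := hp.B_pos hγ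
  have hσ := hp.sigmaD2_pos
  have hq : 0 ≤ p.mD * p.sigmaD2 * γ * z.2.1 ^ (p.nu / 2) / z.2.2 := by positivity
  have ht0 := gammaTail_nonneg p.mD hq
  have ht1 := gammaTail_le_one p.mD hq
  have he : Real.exp (-(p.betaBar * p.B γ / p.A γ * z.1)) ≤ 1 :=
    Real.exp_le_one_iff.2 (by rw [neg_nonpos]; positivity)
  unfold seriesIntegrand
  rw [norm_mul, norm_mul, norm_mul, norm_mul, norm_div, norm_pow, norm_pow, norm_pow, norm_neg,
    Real.norm_of_nonneg hu, Real.norm_of_nonneg (Real.exp_pos _).le,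
    Real.norm_of_nonneg (div_pos hb hA).le, Real.norm_of_nonneg hτ1.le, Real.norm_of_nonneg ht0,
    Real.norm_of_nonneg (Nat.cast_nonneg _)]
  calc _ ≤ ((p.wMax ^ 2) ^ (k + k₂ + 1) * 1) * ((p.betaBar / p.A γ) ^ k₂ / (k₂.factorial : ℝ) *
        (p.PAB γ ^ (k₁ + k₂) * 1)) := by gcongr
    _ = _ := by ring

theorem Valid.integrable_seriesSum (hp : p.Valid) {γ : ℝ} (hγ : 0 < γ) (hA : 0 < p.A γ)
    (k k₁ : ℕ) : Integrable (p.seriesSum γ k k₁) (p.boxMeasure γ) := by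
  refine Integrable.of_bound (p.measurable_seriesSum γ k k₁).aestronglyMeasurable
    ((p.wMax ^ 2) ^ (k + 1) * p.PAB γ ^ k₁) ?_
  filter_upwards [p.ae_boxMeasure γ] with z hz
  obtain ⟨⟨hu1, hu2⟩, ⟨hr1, -⟩, ⟨hτ1, hτ2⟩⟩ := hz
  have hP := hτ1.le.trans hτ2
  have hu : 0 ≤ z.1 := le_trans (by positivity) hu1
  have hr : 0 ≤ z.2.1 := le_trans (by positivity) hr1
  have hb := hp.betaBar_pos
  have hB := hp.B_pos hγ
  have hσ := hp.sigmaD2_pos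
  have hq : 0 ≤ p.mD * p.sigmaD2 * γ * z.2.1 ^ (p.nu / 2) / z.2.2 := by positivity
  have ht0 := gammaTail_nonneg p.mD hq
  have ht1 := gammaTail_le_one p.mD hq
  have he : Real.exp (-(p.betaBar * p.B γ / p.A γ * z.1)) ≤ 1 :=
    Real.exp_le_one_iff.2 (by rw [neg_nonpos]; positivity)
  have he' : Real.exp (-(p.betaBar / p.A γ * z.1 * z.2.2)) ≤ 1 :=
    Real.exp_le_one_iff.2 (by rw [neg_nonpos]; positivity)
  unfold seriesSum
  rw [Real.norm_of_nonneg (by positivity)]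
  calc _ ≤ (p.wMax ^ 2) ^ (k + 1) * 1 * 1 * p.PAB γ ^ k₁ * 1 := by gcongr
    _ = _ := by ring

theorem Valid.hasSum_integral_seriesIntegrand (hp : p.Valid) {γ : ℝ} (hγ : 0 < γ)
    (hA : 0 < p.A γ) (k k₁ : ℕ) :
    HasSum (fun k₂ => ∫ z, p.seriesIntegrand γ k k₁ k₂ z ∂p.boxMeasure γ)
      (∫ z, p.seriesSum γ k k₁ z ∂p.boxMeasure γ) := by
  have hsum : Summable fun k₂ : ℕ => (p.wMax ^ 2) ^ (k + 1) * p.PAB γ ^ k₁ *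
        ((p.wMax ^ 2 * (p.betaBar / p.A γ) * p.PAB γ) ^ k₂ / (k₂.factorial : ℝ)) :=
    (Real.summable_pow_div_factorial _).mul_left _
  exact hasSum_integral_of_dominated_convergence _
    (fun k₂ => (p.measurable_seriesIntegrand γ k k₁ k₂).aestronglyMeasurable)
    (hp.norm_seriesIntegrand_le hγ hA k k₁) (Filter.Eventually.of_forall fun _ => hsum)
    (integrable_const _) (Filter.Eventually.of_forall (p.hasSum_seriesIntegrand γ k k₁))

/-- Binomial expansion of `(τ + B)^k` together with the factorisation of `exp(-β̄ u (τ + B)/A)`; the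
Jacobian `u/A` supplies the extra power of `u/A`. -/
theorem coverageIntegrand_eq_sum {γ : ℝ} (hA : 0 < p.A γ)
    (z : ℝ × (ℝ × ℝ)) :
    p.coverageIntegrand γ z = ∑ k ∈ Finset.range p.mS, ∑ k₁ ∈ Finset.range (k + 1),
      p.alpha * p.zeta k * (k.choose k₁ : ℝ) * (p.B γ ^ (k - k₁) / p.A γ ^ (k + 1)) *
        p.seriesSum γ k k₁ z := by
  unfold coverageIntegrand shadowedRicianDensity
  rw [Finset.mul_sum, Finset.mul_sum, Finset.sum_mul]
  refine Finset.sum_congr rfl fun k _ => ?_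
  have hexp : Real.exp (-(p.beta - p.delta) * (z.1 * (z.2.2 + p.B γ) / p.A γ)) =
      Real.exp (-(p.betaBar * p.B γ / p.A γ * z.1)) *
        Real.exp (-(p.betaBar / p.A γ * z.1 * z.2.2)) := by
    rw [← Real.exp_add]
    congr 1
    unfold betaBar
    ring
  have hpow : (z.1 * (z.2.2 + p.B γ) / p.A γ) ^ k = (z.1 / p.A γ) ^ k *
      ∑ k₁ ∈ Finset.range (k + 1), z.2.2 ^ k₁ * p.B γ ^ (k - k₁) * (k.choose k₁ : ℝ) := by
    rw [← add_pow, ← mul_pow]; congr 1; ring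
  rw [hexp, hpow, Finset.mul_sum, Finset.mul_sum, Finset.sum_mul, Finset.mul_sum, Finset.mul_sum,
    Finset.sum_mul]
  refine Finset.sum_congr rfl fun k₁ _ => ?_
  unfold seriesSum
  rw [div_pow]
  field_simp
  ring

/-- The series integrand is a function of `u` times a function of `(r, τ)`. The first integrates to
the incomplete Gamma difference, the second to the sum over `n` of Meijer differences. The constants
match because `(β̄B/A)^(k+k₂+2) B^(-k₁-k₂-2) β̄^(-k-2)` equals `(β̄/A)^k₂ B^(k-k₁) / A^(k+2)`. -/
theorem Valid.psiTerm_eq (hp : p.Valid) {γ : ℝ} (hγ : 0 < γ) (hA : 0 < p.A γ)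
    (hP : 0 < p.PAB γ) {k k₁ : ℕ} (hk : k₁ ≤ k) (k₂ : ℕ) :
    p.psiTerm γ k k₁ k₂ = ((p.nu / 2 * (p.B γ ^ (k - k₁) / p.A γ ^ (k + 2)) *
      ∫ z, p.seriesIntegrand γ k k₁ k₂ z ∂p.boxMeasure γ : ℝ) : ℂ) := by
  have hb := hp.betaBar_pos
  have hB := hp.B_pos hγ
  have hσ := hp.sigmaD2_pos
  have hmD : (0 : ℝ) < p.mD := Nat.cast_pos.2 hp.mD_pos
  have hh := hp.h0_pos
  have hw := hp.wMin_pos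
  have hwe := hp.wER_pos
  have hc : 0 < p.mD * p.sigmaD2 * γ := by positivity
  set c := p.mD * p.sigmaD2 * γ with hcdef
  have hv : p.h0 ≤ Real.sqrt (p.h0 ^ 2 + p.l ^ 2) :=
    Real.le_sqrt_of_sq_le (by nlinarith [sq_nonneg p.l])
  have hv0 := hh.trans_le hv
  have hvsq : Real.sqrt (p.h0 ^ 2 + p.l ^ 2) ^ 2 = p.h0 ^ 2 + p.l ^ 2 :=
    Real.sq_sqrt (by positivity)
  have hww : p.wMin ^ 2 ≤ p.wMax ^ 2 := by
    rw [hp.wMax_sq]; linarith [mul_pos (mul_pos two_pos hwe) hw]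
  set Fn : ℕ → ℝ × ℝ → ℝ := fun n z => z.2 ^ (k₁ + k₂) *
      ((c * z.1 ^ (p.nu / 2) / z.2) ^ n / (n.factorial : ℝ) *
        Real.exp (-(c * z.1 ^ (p.nu / 2) / z.2))) with hFn
  set m2 := (volume.restrict (Set.Icc (p.h0 ^ 2) (p.h0 ^ 2 + p.l ^ 2))).prod
      (volume.restrict (Set.Ioc 0 (p.PAB γ))) with hm2
  have hFi : ∀ n, Integrable (Fn n) m2 := by
    intro n
    -- Adding 1 fits the closed interval of `r` inside an open interval starting at 0.
    refine (integrable_pow_mul_pow_div_mul_exp_neg (y := p.h0 ^ 2 + p.l ^ 2 + 1) hc.le).mono_measure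
      (Measure.prod_mono (Measure.restrict_mono ?_ le_rfl) le_rfl)
    exact fun x hx => ⟨lt_of_lt_of_le (by positivity) hx.1, by linarith [hx.2]⟩
  have hsumn : ∑ n ∈ Finset.range p.mD,
      ((p.PAB γ ^ varsigma1 k₁ k₂ n * (p.mD * p.sigmaD2 * γ) ^ n / (n.factorial : ℝ) : ℝ) : ℂ) *
      ((((p.h0 ^ 2 + p.l ^ 2) ^ ((p.nu * n + 2) / 2) : ℝ) : ℂ) *
        p.meijerFactor γ (Real.sqrt (p.h0 ^ 2 + p.l ^ 2)) k₁ k₂ n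
      - ((p.h0 ^ (p.nu * n + 2) : ℝ) : ℂ) * p.meijerFactor γ p.h0 k₁ k₂ n) =
      ((p.nu / 2 * ∫ z, z.2 ^ (k₁ + k₂) * gammaTail p.mD (c * z.1 ^ (p.nu / 2) / z.2) ∂m2 : ℝ)
        : ℂ) := by
    have h1 : ∫ z, z.2 ^ (k₁ + k₂) * gammaTail p.mD (c * z.1 ^ (p.nu / 2) / z.2) ∂m2 =
        ∑ n ∈ Finset.range p.mD, ∫ z, Fn n z ∂m2 := by
      rw [← integral_finsetSum _ fun n _ => hFi n]
      congr 1 with z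
      rw [gammaTail, Finset.mul_sum]
    rw [h1, Finset.mul_sum, Complex.ofReal_sum]
    refine Finset.sum_congr rfl fun n _ => ?_
    have h2 := rpow_mul_expRatioIntegral_sub (n := n) (j := k₁ + k₂) hc hP hp.nu_pos hh hv
    rw [hvsq] at h2
    have h3 : (p.h0 ^ 2 + p.l ^ 2) ^ ((p.nu * n + 2) / 2) =
        Real.sqrt (p.h0 ^ 2 + p.l ^ 2) ^ (p.nu * n + 2) := by
      rw [← hvsq, Real.sqrt_sq hv0.le, ← Real.rpow_natCast, ← Real.rpow_mul hv0.le]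
      congr 1; push_cast; ring
    have h4 : varsigma1 k₁ k₂ n = 1 + ((k₁ + k₂ : ℕ) : ℤ) - n := by
      unfold varsigma1; push_cast; ring
    rw [hp.meijerFactor_eq hγ hP hv0, hp.meijerFactor_eq hγ hP hh, ← hcdef, h3, h4, ← h2]
    push_cast
    ring
  have hdelta : deltaGamma ((k : ℝ) + k₂ + 2) (p.betaBar * p.B γ * p.wMin ^ 2 / p.A γ)
        (p.betaBar * p.B γ * p.wMax ^ 2 / p.A γ) =
      (p.betaBar * p.B γ / p.A γ) ^ (k + k₂ + 2) *
        ∫ u in Set.Icc (p.wMin ^ 2) (p.wMax ^ 2),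
          u ^ (k + k₂ + 1) * Real.exp (-(p.betaBar * p.B γ / p.A γ * u)) := by
    have := deltaGamma_nat_mul (j := k + k₂ + 1) (b := p.betaBar * p.B γ / p.A γ)
      (by positivity) (sq_nonneg p.wMin) hww
    rw [← this]
    congr 1
    · push_cast; ring
    · ring
    · ring
  have hsplit : ∫ z, p.seriesIntegrand γ k k₁ k₂ z ∂p.boxMeasure γ =
      (∫ u in Set.Icc (p.wMin ^ 2) (p.wMax ^ 2),
          u ^ (k + k₂ + 1) * Real.exp (-(p.betaBar * p.B γ / p.A γ * u))) *
      ((-(p.betaBar / p.A γ)) ^ k₂ / (k₂.factorial : ℝ) *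
        ∫ z, z.2 ^ (k₁ + k₂) * gammaTail p.mD (c * z.1 ^ (p.nu / 2) / z.2) ∂m2) := by
    rw [← integral_const_mul, ← integral_prod_mul]
    rfl
  unfold psiTerm
  rw [hsumn, hdelta, hsplit, ← Complex.ofReal_mul]
  congr 1
  generalize (∫ u in Set.Icc (p.wMin ^ 2) (p.wMax ^ 2),
          u ^ (k + k₂ + 1) * Real.exp (-(p.betaBar * p.B γ / p.A γ * u))) = I
  generalize (∫ z, z.2 ^ (k₁ + k₂) * gammaTail p.mD (c * z.1 ^ (p.nu / 2) / z.2) ∂m2) = J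
  -- Writing `k = k₁ + d` removes the truncated subtraction in the exponent of `B`.
  obtain ⟨d, rfl⟩ := Nat.exists_eq_add_of_le hk
  have hz : p.B γ ^ (-(k₁ : ℤ) - (k₂ : ℤ) - 2) = (p.B γ ^ (k₁ + k₂ + 2))⁻¹ := by
    rw [← zpow_natCast, ← zpow_neg]; congr 1; push_cast; ring
  rw [hz, Nat.add_sub_cancel_left, neg_pow (p.betaBar / p.A γ), mul_div_assoc p.betaBar, mul_pow, div_pow, div_pow]
  field_simp
  ring

end Params

/-! ### The closed form, the boundary case and the empty events -/

namespace Params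

variable {p : Params}

theorem psiTerm_of_PAB_eq_zero (hp : p.Valid) {γ : ℝ} (hP : p.PAB γ = 0) (k k₁ k₂ : ℕ) :
    p.psiTerm γ k k₁ k₂ = 0 := by
  unfold psiTerm
  simp [meijerFactor_of_PAB_eq_zero hp hP]

theorem Psi1_of_PAB_eq_zero (hp : p.Valid) {γ : ℝ} (hP : p.PAB γ = 0) : p.Psi1 γ = 0 := by
  unfold Psi1
  simp [psiTerm_of_PAB_eq_zero hp hP]

theorem Valid.hasSum_psiTerm (hp : p.Valid) {γ : ℝ} (hγ : 0 < γ) (hA : 0 < p.A γ)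
    (hP : 0 < p.PAB γ) {k k₁ : ℕ} (hk : k₁ ≤ k) :
    HasSum (fun k₂ => p.psiTerm γ k k₁ k₂) ((p.nu / 2 * (p.B γ ^ (k - k₁) / p.A γ ^ (k + 2)) *
      ∫ z, p.seriesSum γ k k₁ z ∂p.boxMeasure γ : ℝ) : ℂ) := by
  simp_rw [hp.psiTerm_eq hγ hA hP hk]
  exact Complex.hasSum_ofReal.2 ((hp.hasSum_integral_seriesIntegrand hγ hA k k₁).mul_left _)

/-- Summing the series and comparing constants: the prefactor's `A/ν` meets `(ν/2)/A^(k+2)` from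
each term, and `w_max² - w_min² = 2 w_er w_min` absorbs the remaining factor 2. -/
theorem Valid.Psi1_eq_integral (hp : p.Valid) {γ : ℝ} (hγ : 0 < γ) (hA : 0 < p.A γ)
    (hP : 0 < p.PAB γ) :
    p.Psi1 γ = ((1 / (p.wMax ^ 2 - p.wMin ^ 2) * (1 / p.l ^ 2) *
      ∫ z, p.coverageIntegrand γ z ∂p.boxMeasure γ : ℝ) : ℂ) := by
  have hl := hp.l_pos
  have hw := hp.wMin_pos
  have hwe := hp.wER_pos
  have hν := hp.nu_pos
  have h1 : ∫ z, p.coverageIntegrand γ z ∂p.boxMeasure γ =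
      ∑ k ∈ Finset.range p.mS, ∑ k₁ ∈ Finset.range (k + 1),
      p.alpha * p.zeta k * (k.choose k₁ : ℝ) * (p.B γ ^ (k - k₁) / p.A γ ^ (k + 1)) *
        ∫ z, p.seriesSum γ k k₁ z ∂p.boxMeasure γ := by
    simp_rw [coverageIntegrand_eq_sum hA]
    rw [integral_finsetSum _ fun k _ => integrable_finsetSum _ fun k₁ _ =>
      (hp.integrable_seriesSum hγ hA k k₁).const_mul _]
    refine Finset.sum_congr rfl fun k _ => ?_
    rw [integral_finsetSum _ fun k₁ _ => (hp.integrable_seriesSum hγ hA k k₁).const_mul _]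
    exact Finset.sum_congr rfl fun k₁ _ => integral_const_mul _ _
  have h2 : ∑ k ∈ Finset.range p.mS, (p.zeta k : ℂ) *
      ∑ k₁ ∈ Finset.range (k + 1), (k.choose k₁ : ℂ) * ∑' k₂ : ℕ, p.psiTerm γ k k₁ k₂ =
      ((∑ k ∈ Finset.range p.mS, p.zeta k * ∑ k₁ ∈ Finset.range (k + 1), (k.choose k₁ : ℝ) *
        (p.nu / 2 * (p.B γ ^ (k - k₁) / p.A γ ^ (k + 2)) *
          ∫ z, p.seriesSum γ k k₁ z ∂p.boxMeasure γ) : ℝ) : ℂ) := by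
    rw [Complex.ofReal_sum]
    refine Finset.sum_congr rfl fun k _ => ?_
    rw [Complex.ofReal_mul, Complex.ofReal_sum]
    congr 1
    refine Finset.sum_congr rfl fun k₁ hk₁ => ?_
    rw [(hp.hasSum_psiTerm hγ hA hP (Nat.lt_succ_iff.1 (Finset.mem_range.1 hk₁))).tsum_eq]
    push_cast
    ring
  unfold Psi1
  rw [h2, h1, ← Complex.ofReal_mul, hp.wMax_sq, add_sub_cancel_left]
  congr 1
  rw [Finset.mul_sum, Finset.mul_sum]
  refine Finset.sum_congr rfl fun k _ => ?_
  rw [Finset.mul_sum, Finset.mul_sum, Finset.mul_sum]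
  refine Finset.sum_congr rfl fun k₁ _ => ?_
  generalize ∫ z, p.seriesSum γ k k₁ z ∂p.boxMeasure γ = I
  rw [show k + 2 = (k + 1) + 1 by ring, pow_succ (p.A γ) (k + 1)]
  field_simp

/-- The event is empty, not merely null: a positive noise power forces `A t > B` for `t = |g_sr|²
w_sr^(-2)`. One criterion serves both a low threshold and `A ≤ 0`. -/
theorem Valid.P1_eq_zero (hp : p.Valid) {Ω : Type*} [MeasurableSpace Ω] (P : Measure Ω)
    (gsr grd : Ω → ℂ) (S D : Ω → EuclideanSpace ℝ (Fin 3)) {γ : ℝ} (hγ : 0 < γ)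
    (h : ∀ t : ℝ, 0 ≤ t → p.etaS * t ≤ p.Pth → p.A γ * t ≤ p.B γ) :
    p.P1 P gsr grd S D γ = 0 := by
  unfold P1
  convert! measureReal_empty (μ := P)
  refine Set.eq_empty_of_forall_notMem fun ω hω => ?_
  obtain ⟨h1, h2⟩ := hω
  rw [hp.lt_snrLinear_iff (sq_nonneg _) (sq_nonneg _) dist_nonneg] at h1
  have hσ := hp.sigmaD2_pos
  have h3 := h (‖gsr ω‖ ^ 2 * dist (S ω) p.posR ^ (-2 : ℤ))
    (mul_nonneg (sq_nonneg _) (Even.zpow_nonneg (by decide) _)) (by rwa [← mul_assoc])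
  have h4 : 0 ≤ ‖grd ω‖ ^ 2 * dist p.posR (D ω) ^ (-p.nu) := by positivity
  have h5 := mul_nonpos_of_nonneg_of_nonpos h4 (sub_nonpos.2 h3)
  have h6 : 0 < γ * p.sigmaD2 := by positivity
  linarith

end Params

end

theorem theorem1 {Ω : Type*} [MeasurableSpace Ω] (P : Measure Ω) [IsProbabilityMeasure P]
    (p : Params) (hp : p.Valid)
    (gsr grd : Ω → ℂ) (S D : Ω → EuclideanSpace ℝ (Fin 3))
    (hgsr : HasLaw (fun ω => ‖gsr ω‖ ^ 2) p.shadowedRicianLaw P)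
    (hgrd : HasLaw (fun ω => ‖grd ω‖ ^ 2) p.nakagamiPowerLaw P)
    (hS : HasLaw S p.satelliteLaw P)
    (hD : HasLaw D p.groundUserLaw P)
    (hindep : iIndepFun
      (![fun ω => ‖gsr ω‖ ^ 2, fun ω => ‖grd ω‖ ^ 2, fun ω => dist (S ω) p.posR,
        fun ω => dist p.posR (D ω)] : Fin 4 → Ω → ℝ) P)
    (γS : ℝ) (hγS : 0 < γS) :
    (γS < p.muPrime → p.B γS / p.A γS * p.etaS ≤ p.Pth →
      (∀ k ∈ Finset.range p.mS, ∀ k₁ ∈ Finset.range (k + 1),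
        Summable fun k₂ : ℕ => p.psiTerm γS k k₁ k₂) ∧
      ((p.P1 P gsr grd S D γS : ℝ) : ℂ) = p.Psi1 γS) ∧
    (γS < p.muPrime → p.Pth ≤ p.B γS / p.A γS * p.etaS → p.P1 P gsr grd S D γS = 0) ∧
    (p.muPrime ≤ γS → p.P1 P gsr grd S D γS = 0) := by
  have hη := hp.etaS_pos
  have hzero : γS < p.muPrime → p.Pth ≤ p.B γS / p.A γS * p.etaS →
      p.P1 P gsr grd S D γS = 0 := by
    intro h1 h2
    have hA := hp.A_pos_iff.2 h1
    refine hp.P1_eq_zero P gsr grd S D hγS fun t _ ht2 => ?_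
    have h3 : p.etaS * t ≤ p.etaS * (p.B γS / p.A γS) := by linarith
    have h4 := le_of_mul_le_mul_left h3 hη
    rw [le_div_iff₀ hA] at h4
    linarith
  refine ⟨fun h1 h2 => ?_, hzero, fun h1 => ?_⟩
  · have hA := hp.A_pos_iff.2 h1
    have hPAB : p.PAB γS = (p.Pth - p.B γS / p.A γS * p.etaS) * (p.A γS / p.etaS) := by
      unfold Params.PAB; field_simp
    -- At equality `P_{A,B} = 0`, and both the probability and the closed form vanish; otherwise
    -- `P_{A,B} > 0` and both equal the same box integral.
    rcases h2.eq_or_lt with h3 | h3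
    · have hP : p.PAB γS = 0 := by rw [hPAB, h3, sub_self, zero_mul]
      refine ⟨fun k _ k₁ _ => ?_, ?_⟩
      · simp_rw [Params.psiTerm_of_PAB_eq_zero hp hP]
        exact summable_zero
      · rw [hzero h1 h3.ge, Params.Psi1_of_PAB_eq_zero hp hP, Complex.ofReal_zero]
    · have hP : 0 < p.PAB γS := by
        rw [hPAB]
        exact mul_pos (sub_pos.2 h3) (div_pos hA hη)
      refine ⟨fun k _ k₁ hk₁ => (hp.hasSum_psiTerm hγS hA hP
        (Nat.lt_succ_iff.1 (Finset.mem_range.1 hk₁))).summable, ?_⟩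
      rw [hp.P1_eq_integral hgsr hgrd hS hD hindep hγS hA, hp.Psi1_eq_integral hγS hA hP]
  · refine hp.P1_eq_zero P gsr grd S D hγS fun t ht _ => ?_
    have hA : p.A γS ≤ 0 := not_lt.1 fun h => h1.not_gt (hp.A_pos_iff.1 h)
    have hB := hp.B_pos hγS
    nlinarith
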